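/- Let $\rho, C_p, k, \Delta H^*, D>0$ and $T_m\in\mathbb R$, and put $\alpha=\frac{k}{\rho C_p}$, $\beta=\frac{k}{\rho\,\Delta H^*}$. Consider the one-phase Stefan problem with boundary heat flux delayed by $D$: for $t>0$, \[ T_t(x,t)=\alpha T_{xx}(x,t)\ \ (0\le x\le s(t)),\qquad -kT_x(0,t)=q_c(t-D),\qquad T(s(t),t)=T_m,\qquad \dot s(t)=-\beta T_x(s(t),t), \] with initial values $T(x,0)=T_0(x)$ on $[0,s_0]$ and $s(0)=s_0$, under the feedback law, for $t\ge 0$, \[ q_c(t)=-c\left(\int_{t-D}^{t}q_c(\theta)\,d\theta+\frac{k}{\alpha}\int_0^{s(t)}(T(x,t)-T_m)\,dx+\frac{k}{\beta}(s(t)-s_r)\right) \] with an arbitrary gain $c>0$ and a setpoint $s_r$. Assume: 1. $s_0>0$, and there is $H>0$ with $T_m\le T_0(x)\le T_m+H(s_0-x)$ for all $x\in(0,s_0)$; 2. the past input, which is integrable on $(-D,0)$, satisfies $q_c(t)\ge 0$ for $-D<t<0$; 3. $\displaystyle s_r>s_0+\beta\left(\int_{-D}^0\frac{q_c(t)}{k}\,dt+\frac1\alpha\int_0^{s_0}(T_0(x)-T_m)\,dx\right)$.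 Solutions are meant on a time interval $[0,\tau)$, $0<\tau\le\infty$, and in the following sense: $s$ is positive and continuous on $[0,\tau)$ and differentiable on $(0,\tau)$; $T$ is continuous on $\{0\le t<\tau,\ 0\le x\le s(t)\}$; $T_x$ and $T_{xx}$ exist and are continuous on $\{0<t<\tau,\ 0\le x\le s(t)\}$ (one-sided at the ends), and $T_t=\alpha T_{xx}$ for $0<x<s(t)$, which extends to the boundary by continuity; the input $q_c$, including its past, is continuous on $(-D,\tau)$; and $\|T(\cdot,t)-T_m\|_{H^1(0,s(t))}\to\|T_0-T_m\|_{H^1(0,s_0)}$ as $t\to0^+$. Then every such closed-loop solution keeps the model valid, \[ T(x,t)\ge T_m\qquad\text{for all } x\in[0,s(t)],\ 0<t<\tau, \] and the closed loop is exponentially stable in the $H^1$ norm: there are constants $M,b>0$, depending only on the physical parameters, $D$, $c$ and $s_r$, such that for every such solution \[ \Xi(t)\le M e^{-bt}\,\Xi(0)\quad (0\le t<\tau),\qquad \Xi(t)=\|T(\cdot,t)-T_m\|^2_{H^1(0,s(t))}+(s(t)-s_r)^2+\|q_c(t-\cdot)\|^2_{H^1(0,D)}, \] where an $H^1$ norm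 is $+\infty$ for a function that is not in $H^1$. -/

import Mathlib

open Set Filter Topology MeasureTheory
open scoped ENNReal ContDiff

noncomputable section

namespace DelayedStefan

/-- The physical data of the one-phase Stefan problem with delayed boundary heat flux:
density, heat capacity, heat conductivity and latent heat of fusion of the material,
its melting temperature, and the actuator delay. -/
structure Params where
  rho : ℝ
  Cp : ℝ
  k : ℝ
  latentHeat : ℝ
  Tm : ℝ
  D : ℝ
  rho_pos : 0 < rho
  Cp_pos : 0 < Cp
  k_pos : 0 < k
  latentHeat_pos : 0 < latentHeat
  D_pos : 0 < D

/-- The diffusivity `α = k / (ρ C_p)`. -/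
def Params.alpha (P : Params) : ℝ := P.k / (P.rho * P.Cp)

/-- The Stefan coefficient `β = k / (ρ ΔH)`. -/
def Params.beta (P : Params) : ℝ := P.k / (P.rho * P.latentHeat)

/-- `g` is a weak derivative of `f` on the open interval `(a, b)`. -/
def IsWeakDeriv (a b : ℝ) (f g : ℝ → ℝ) : Prop :=
  LocallyIntegrableOn f (Ioo a b) ∧ LocallyIntegrableOn g (Ioo a b) ∧
    ∀ φ : ℝ → ℝ, ContDiff ℝ ∞ φ → HasCompactSupport φ → tsupport φ ⊆ Ioo a b →
      ∫ x in Ioo a b, f x * deriv φ x = -∫ x in Ioo a b, g x * φ x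

/-- The squared norm of `f` in the Sobolev space `H¹(a, b)`, with values in `[0, ∞]`. The weak
derivative is unique up to null sets, so the infimum is attained by each weak derivative; the
value is `∞` exactly when `f` does not belong to `H¹(a, b)`. -/
def h1NormSq (a b : ℝ) (f : ℝ → ℝ) : ℝ≥0∞ :=
  ⨅ (g : ℝ → ℝ) (_ : IsWeakDeriv a b f g),
    ∫⁻ x in Ioo a b, ENNReal.ofReal (f x ^ 2 + g x ^ 2)

/-- The space derivative `T_x(x, t)` on the liquid phase `[0, s(t)]`, one-sided at the two
end points. The temperature is written `T x t`. -/
def spaceDeriv (s : ℝ → ℝ) (T : ℝ → ℝ → ℝ) (x t : ℝ) : ℝ :=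
  derivWithin (fun y => T y t) (Icc 0 (s t)) x

/-- The liquid phase, in space-time, over the times `0 ≤ t < τ`; points are pairs `(x, t)`. -/
def liquid (s : ℝ → ℝ) (τ : EReal) : Set (ℝ × ℝ) :=
  {p | 0 ≤ p.2 ∧ (p.2 : EReal) < τ ∧ 0 ≤ p.1 ∧ p.1 ≤ s p.2}

/-- The liquid phase, in space-time, over the times `0 < t < τ`. -/
def liquidPos (s : ℝ → ℝ) (τ : EReal) : Set (ℝ × ℝ) :=
  {p | 0 < p.2 ∧ (p.2 : EReal) < τ ∧ 0 ≤ p.1 ∧ p.1 ≤ s p.2}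

/-- `(T, s)` is a classical solution, on the time interval `[0, τ)` with `0 < τ ≤ ∞`, of the
one-phase Stefan problem with initial data `(T₀, s₀)` and delayed boundary heat flux
`q (t - D)`; the values of `q` on `(-D, 0)` are the past input. -/
structure IsStefanSolution (P : Params) (s₀ : ℝ) (T₀ : ℝ → ℝ) (τ : EReal)
    (q s : ℝ → ℝ) (T : ℝ → ℝ → ℝ) : Prop where
  /-- the past input is integrable -/
  integrable_past : IntegrableOn q (Ioo (-P.D) 0)
  /-- the input signal, including its past, is continuous on `(-D, τ)` -/
  continuous_input : ContinuousOn q {t : ℝ | -P.D < t ∧ (t : EReal) < τ}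
  continuous_interface : ContinuousOn s {t : ℝ | 0 ≤ t ∧ (t : EReal) < τ}
  interface_pos : ∀ t : ℝ, 0 ≤ t → (t : EReal) < τ → 0 < s t
  continuous_temp : ContinuousOn (fun p : ℝ × ℝ => T p.1 p.2) (liquid s τ)
  differentiable_temp : ∀ t : ℝ, 0 < t → (t : EReal) < τ →
    DifferentiableOn ℝ (fun x => T x t) (Icc 0 (s t))
  continuous_spaceDeriv :
    ContinuousOn (fun p : ℝ × ℝ => spaceDeriv s T p.1 p.2) (liquidPos s τ)
  differentiable_spaceDeriv : ∀ t : ℝ, 0 < t → (t : EReal) < τ →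
    DifferentiableOn ℝ (fun x => spaceDeriv s T x t) (Icc 0 (s t))
  continuous_spaceDeriv₂ :
    ContinuousOn (fun p : ℝ × ℝ => spaceDeriv s (spaceDeriv s T) p.1 p.2) (liquidPos s τ)
  /-- the heat equation `T_t = α T_xx` (by the continuity of `T_xx` it extends to the boundary) -/
  heat_equation : ∀ t : ℝ, 0 < t → (t : EReal) < τ → ∀ x : ℝ, 0 < x → x < s t →
    HasDerivAt (fun r => T x r) (P.alpha * spaceDeriv s (spaceDeriv s T) x t) t
  /-- the delayed boundary heat flux `-k T_x(0, t) = q(t - D)` -/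
  boundary_flux : ∀ t : ℝ, 0 < t → (t : EReal) < τ →
    -P.k * spaceDeriv s T 0 t = q (t - P.D)
  /-- the isothermal interface condition `T(s(t), t) = T_m` -/
  interface_temp : ∀ t : ℝ, 0 ≤ t → (t : EReal) < τ → T (s t) t = P.Tm
  initial_temp : ∀ x ∈ Icc 0 s₀, T x 0 = T₀ x
  initial_interface : s 0 = s₀
  /-- the Stefan condition `s'(t) = -β T_x(s(t), t)` -/
  stefan_condition : ∀ t : ℝ, 0 < t → (t : EReal) < τ →
    HasDerivAt s (-P.beta * spaceDeriv s T (s t) t) t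
  /-- the `H¹` norm of the temperature profile takes its initial value continuously -/
  h1_initial : Tendsto (fun t => h1NormSq 0 (s t) (fun x => T x t - P.Tm)) (𝓝[>] 0)
    (𝓝 (h1NormSq 0 s₀ (fun x => T₀ x - P.Tm)))

/-- The delay-compensated feedback law with gain `c` and setpoint `sr`, for `0 ≤ t < τ`. -/
def FeedbackLaw (P : Params) (c sr : ℝ) (τ : EReal) (q s : ℝ → ℝ) (T : ℝ → ℝ → ℝ) : Prop :=
  ∀ t : ℝ, 0 ≤ t → (t : EReal) < τ →
    q t = -c * ((∫ θ in (t - P.D)..t, q θ)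
      + P.k / P.alpha * (∫ x in (0 : ℝ)..(s t), (T x t - P.Tm))
      + P.k / P.beta * (s t - sr))

/-- Admissible initial data. -/
def AdmissibleInitial (P : Params) (s₀ : ℝ) (T₀ : ℝ → ℝ) : Prop :=
  0 < s₀ ∧ ∃ H : ℝ, 0 < H ∧ ∀ x ∈ Ioo 0 s₀, P.Tm ≤ T₀ x ∧ T₀ x ≤ P.Tm + H * (s₀ - x)

/-- The past input is nonnegative. -/
def NonnegPast (P : Params) (q : ℝ → ℝ) : Prop := ∀ t ∈ Ioo (-P.D) 0, 0 ≤ q t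

/-- The setpoint restriction. -/
def SetpointRestriction (P : Params) (s₀ : ℝ) (T₀ q : ℝ → ℝ) (sr : ℝ) : Prop :=
  sr > s₀ + P.beta * ((∫ t in (-P.D)..0, q t / P.k)
    + 1 / P.alpha * ∫ x in (0 : ℝ)..s₀, (T₀ x - P.Tm))

/-- The squared norm of the closed-loop state at time `t`:
`‖T(·,t) - T_m‖²_{H¹(0,s(t))} + (s(t) - s_r)² + ‖q(t - ·)‖²_{H¹(0,D)}`. -/
def stateNormSq (P : Params) (sr : ℝ) (q s : ℝ → ℝ) (T : ℝ → ℝ → ℝ) (t : ℝ) : ℝ≥0∞ :=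
  h1NormSq 0 (s t) (fun x => T x t - P.Tm) + ENNReal.ofReal ((s t - sr) ^ 2)
    + h1NormSq 0 P.D (fun x => q (t - x))

end DelayedStefan

end

noncomputable section

namespace DelayedStefan

/-! ### Auxiliary results on real integrals -/

/-! Write u = T - T_m and let E(t) be the bracket in the feedback law, so q = -cE. Heat leaving the
input history enters the liquid at x = 0, and heat leaving the liquid at the interface melts it;
hence E' = q = -cE, and q(t) = q(0) exp(-ct) for t ≥ 0 (`ClosedLoop.input_eq`). The setpoint
restriction says that q(0) > 0 (`IsStefanSolution.initial_input_pos`).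

The balance is differentiated only while the interface does not retreat, so signs and balance are
proved together by the method of steps (`ClosedLoop.delayed_input_nonneg`). A nonnegative delayed
input gives u ≥ 0 by the maximum principle (`MovingHeat.nonneg`), hence u_x ≤ 0 at the interface and
s is nondecreasing; then the balance makes q nonnegative for one more delay. The signs in the
feedback law also give s ≤ s_r, a bound on the domain that does not depend on the solution.

For stability, the sum of the squared L² norms of u and u_x is differentiated. The cubic term β
u_x(s(t),t)³ is nonpositive. The term (2/k) q(t-D) α u_xx(0,t) is (2/k) q(t-D) times the time
derivative of u(0,t); integration by parts in time moves that derivative onto the input. What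
remains contains u(0,t), which the gradient controls, and the input and its derivative, which decay
explicitly (`ClosedLoop.energy_estimate`, `ClosedLoop.energy_decay`). Solving the feedback law for s
- s_r bounds the interface error by decaying quantities, and `ClosedLoop.exists_exponential_bound`
collects the constants.

Two points of regularity shape the argument. No mixed derivative u_xt is assumed, so all space
integrals are differentiated through time increments of u, from the right. At time 0 the temperature
and the past input are only weakly differentiable: energy estimates start at a positive time and
pass to the limit, and a continuous function is recovered from its weak derivative by
`IsWeakDeriv.sub_eq_integral`. -/

/-- An integral over a fixed interval depends continuously on a parameter in a retract. -/
theorem continuousOn_integral_of_retract {X : Type*} [TopologicalSpace X] {K : Set X} {ρ : X → X}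
    (hρ : Continuous ρ) (hK : ∀ x, ρ x ∈ K) (hid : ∀ x ∈ K, ρ x = x) {G : X → ℝ → ℝ} {a b : ℝ}
    (hab : a ≤ b) (hG : ContinuousOn (fun p : X × ℝ => G p.1 p.2) (K ×ˢ Icc a b)) :
    ContinuousOn (fun x => ∫ y in a..b, G x y) K := by
  -- Precomposing with the retractions onto K and [a, b] turns continuity on K × [a, b] into
  -- continuity everywhere, without changing the integrand where it matters.
  have hc : Continuous (Function.uncurry fun (x : X) (y : ℝ) =>
      G (ρ x) (projIcc a b hab y : ℝ)) :=
    hG.comp_continuous ((hρ.comp continuous_fst).prodMk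
      (continuous_subtype_val.comp ((continuous_projIcc (h := hab)).comp continuous_snd)))
      fun p => ⟨hK p.1, (projIcc a b hab p.2).2⟩
  refine (intervalIntegral.continuous_parametric_intervalIntegral_of_continuous'
    (μ := volume) hc a b).continuousOn.congr fun x hx => ?_
  refine intervalIntegral.integral_congr fun y hy => ?_
  rw [uIcc_of_le hab] at hy
  simp only [projIcc_of_mem hab hy, hid x hx]

theorem continuousOn_parametric_integral {G : ℝ → ℝ → ℝ} {a b c d : ℝ} (hab : a ≤ b) (hcd : c ≤ d)
    (hG : ContinuousOn (fun p : ℝ × ℝ => G p.1 p.2) (Icc a b ×ˢ Icc c d)) :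
    ContinuousOn (fun r => ∫ x in a..b, G x r) (Icc c d) :=
  continuousOn_integral_of_retract (ρ := fun r => (projIcc c d hcd r : ℝ))
    (continuous_subtype_val.comp continuous_projIcc) (fun r => (projIcc c d hcd r).2)
    (fun r hr => by rw [projIcc_of_mem hcd hr]) hab
    (hG.comp (continuousOn_snd.prodMk continuousOn_fst) fun _ hp => ⟨hp.2, hp.1⟩)

/-- Integration by parts for two functions given as indefinite integrals. -/
theorem integral_deriv_mul_add_of_primitive {f g f' g' : ℝ → ℝ} {a b : ℝ} (hab : a ≤ b)
    (hf' : IntervalIntegrable f' volume a b) (hg' : IntervalIntegrable g' volume a b)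
    (hf : ∀ x ∈ Icc a b, f x = f a + ∫ y in a..x, f' y)
    (hg : ∀ x ∈ Icc a b, g x = g a + ∫ y in a..x, g' y) :
    ∫ x in a..b, (f' x * g x + f x * g' x) = f b * g b - f a * g a := by
  have key : ∀ {h h' : ℝ → ℝ} (_ : IntervalIntegrable h' volume a b),
      AbsolutelyContinuousOnInterval (fun x => h a + ∫ y in a..x, h' y) a b ∧
      ∀ᵐ x, x ∈ uIcc a b → HasDerivAt (fun x => h a + ∫ y in a..x, h' y) (h' x) x := by
    intro h h' hi
    have hconst : AbsolutelyContinuousOnInterval (fun _ : ℝ => h a) a b :=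
      ((LipschitzWith.const (h a)).lipschitzOnWith (s := uIcc a b)).absolutelyContinuousOnInterval
    refine ⟨hconst.fun_add
      (hi.absolutelyContinuousOnInterval_intervalIntegral left_mem_uIcc), ?_⟩
    filter_upwards [hi.ae_hasDerivAt_integral] with x hx hxm
    exact (hx hxm a left_mem_uIcc).const_add _
  obtain ⟨hfa, hfd⟩ := key (h := f) hf'
  obtain ⟨hga, hgd⟩ := key (h := g) hg'
  have := hfa.integral_deriv_mul_eq_sub hga
  rw [← hf b (right_mem_Icc.2 hab), ← hg b (right_mem_Icc.2 hab), ← hf a (left_mem_Icc.2 hab),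
    ← hg a (left_mem_Icc.2 hab)] at this
  rw [← this]
  refine intervalIntegral.integral_congr_ae ?_
  filter_upwards [hfd, hgd] with x h1 h2 hx
  have hx' : x ∈ uIcc a b := uIoc_subset_uIcc hx
  rw [(h1 hx').deriv, (h2 hx').deriv]
  rw [uIcc_of_le hab] at hx'
  rw [← hf x hx', ← hg x hx']

/-- The Cauchy–Schwarz inequality against the constant function. -/
theorem sq_integral_le {f : ℝ → ℝ} {a b : ℝ} (hab : a ≤ b) (hf : IntervalIntegrable f volume a b)
    (hf2 : IntervalIntegrable (fun x => f x ^ 2) volume a b) :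
    (∫ x in a..b, f x) ^ 2 ≤ (b - a) * ∫ x in a..b, f x ^ 2 := by
  rcases hab.eq_or_lt with rfl | hlt
  · simp
  have hpos : 0 < b - a := sub_pos.2 hlt
  -- m is the mean of f; the inequality says that the variance is nonnegative.
  set m := (∫ x in a..b, f x) / (b - a) with hm
  have h0 : 0 ≤ ∫ x in a..b, (f x - m) ^ 2 :=
    intervalIntegral.integral_nonneg hab fun x _ => sq_nonneg _
  have h1 : ∫ x in a..b, (f x - m) ^ 2
      = (∫ x in a..b, f x ^ 2) - 2 * m * (∫ x in a..b, f x) + (b - a) * m ^ 2 := by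
    have : (fun x => (f x - m) ^ 2) = fun x => f x ^ 2 - 2 * m * f x + m ^ 2 := by
      funext x; ring
    rw [this, intervalIntegral.integral_add (hf2.sub (hf.const_mul _)) (by simp),
      intervalIntegral.integral_sub hf2 (hf.const_mul _), intervalIntegral.integral_const_mul]
    simp
  have h2 : (∫ x in a..b, f x) = m * (b - a) := by rw [hm]; field_simp
  rw [h1, h2] at h0
  rw [h2]
  nlinarith

/-! ### Weak derivatives -/

theorem exists_Icc_of_compact_subset_Ioo {K : Set ℝ} {a b : ℝ} (hab : a < b) (hK : IsCompact K)
    (hs : K ⊆ Ioo a b) : ∃ a' b', a < a' ∧ a' ≤ b' ∧ b' < b ∧ K ⊆ Icc a' b' := by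
  rcases K.eq_empty_or_nonempty with rfl | hne
  · exact ⟨(a + b) / 2, (a + b) / 2, by linarith, le_rfl, by linarith, empty_subset _⟩
  · exact ⟨sInf K, sSup K, (hs (hK.sInf_mem hne)).1,
      csInf_le_csSup hne hK.bddBelow hK.bddAbove, (hs (hK.sSup_mem hne)).2,
      fun x hx => ⟨csInf_le hK.bddBelow hx, le_csSup hK.bddAbove hx⟩⟩

theorem integrableOn_mul_of_tsupport_subset {f φ : ℝ → ℝ} {a b : ℝ}
    (hf : LocallyIntegrableOn f (Ioo a b)) (hφ : Continuous φ) (hc : HasCompactSupport φ)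
    (hs : tsupport φ ⊆ Ioo a b) : IntegrableOn (fun x => f x * φ x) (Ioo a b) := by
  have h1 : IntegrableOn f (tsupport φ) := hf.integrableOn_compact_subset hs hc
  have h2 : IntegrableOn (fun x => f x * φ x) (tsupport φ) :=
    h1.mul_continuousOn hφ.continuousOn hc
  refine h2.of_forall_sdiff_eq_zero measurableSet_Ioo fun x hx => ?_
  rw [image_eq_zero_of_notMem_tsupport hx.2, mul_zero]

/-- Integration by parts on a compact interval around the support of the test function: g need not
be integrable up to a and b. -/
theorem isWeakDeriv_of_primitive {f g : ℝ → ℝ} {a b : ℝ} (hab : a < b)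
    (hf : ContinuousOn f (Ioo a b)) (hg : LocallyIntegrableOn g (Ioo a b))
    (h : ∀ x ∈ Ioo a b, ∀ y ∈ Ioo a b, x ≤ y → f y - f x = ∫ z in x..y, g z) :
    IsWeakDeriv a b f g := by
  refine ⟨hf.locallyIntegrableOn measurableSet_Ioo, hg, fun φ hφ hc hs => ?_⟩
  obtain ⟨a', b', ha, hab', hb, hK⟩ := exists_Icc_of_compact_subset_Ioo hab hc hs
  -- Points strictly between the support and the ends, so that φ vanishes there and no boundary term
  -- survives.
  set a₁ := (a + a') / 2
  set b₁ := (b' + b) / 2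
  have ha1 : a < a₁ := by simp only [a₁]; linarith
  have ha2 : a₁ < a' := by simp only [a₁]; linarith
  have hb1 : b₁ < b := by simp only [b₁]; linarith
  have hb2 : b' < b₁ := by simp only [b₁]; linarith
  have hle : a₁ ≤ b₁ := by linarith
  have hsub : Icc a₁ b₁ ⊆ Ioo a b := fun x hx => ⟨ha1.trans_le hx.1, hx.2.trans_lt hb1⟩
  have hφ0 : ∀ x, x ∉ Icc a' b' → φ x = 0 := fun x hx =>
    image_eq_zero_of_notMem_tsupport fun hx' => hx (hK hx')
  have hdφ0 : ∀ x, x ∉ Icc a' b' → deriv φ x = 0 := fun x hx =>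
    image_eq_zero_of_notMem_tsupport fun hx' => hx (hK (tsupport_deriv_subset hx'))
  have hdφ : Continuous (deriv φ) := (hφ.continuous_deriv (by simp))
  have hgi : IntervalIntegrable g volume a₁ b₁ := by
    rw [intervalIntegrable_iff_integrableOn_Icc_of_le hle]
    exact hg.integrableOn_compact_subset hsub isCompact_Icc
  have hfi : ContinuousOn f (Icc a₁ b₁) := hf.mono hsub
  have key := integral_deriv_mul_add_of_primitive (f := f) (g := φ) hle hgi
    (hdφ.intervalIntegrable a₁ b₁)
    (fun x hx => by
      rw [← h a₁ (hsub (left_mem_Icc.2 hle)) x (hsub hx) hx.1]; ring)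
    (fun x hx => by
      rw [intervalIntegral.integral_deriv_eq_sub
        (fun y _ => (hφ.differentiable (by simp)) y) (hdφ.intervalIntegrable _ _)]; ring)
  rw [hφ0 b₁ (fun hx => by linarith [hx.2]), hφ0 a₁ (fun hx => by linarith [hx.1]),
    intervalIntegral.integral_add
      (hgi.mul_continuousOn hφ.continuous.continuousOn)
      ((hdφ.intervalIntegrable a₁ b₁).continuousOn_mul (by rwa [uIcc_of_le hle]))] at key
  have conv : ∀ w : ℝ → ℝ, (∀ x, x ∉ Icc a' b' → w x = 0) →
      ∫ x in Ioo a b, w x = ∫ x in a₁..b₁, w x := by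
    intro w hw
    rw [intervalIntegral.integral_of_le hle]
    refine (setIntegral_eq_of_subset_of_forall_sdiff_eq_zero measurableSet_Ioo
      (Ioc_subset_Icc_self.trans hsub) fun x hx => hw x fun hx' => hx.2 ?_)
    exact ⟨ha2.trans_le hx'.1, hx'.2.trans hb2.le⟩
  rw [conv (fun x => f x * deriv φ x) (fun x hx => by simp [hdφ0 x hx]),
    conv (fun x => g x * φ x) (fun x hx => by simp [hφ0 x hx])]
  linarith

theorem IsWeakDeriv.ae_eq {f g₁ g₂ : ℝ → ℝ} {a b : ℝ} (h₁ : IsWeakDeriv a b f g₁)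
    (h₂ : IsWeakDeriv a b f g₂) : ∀ᵐ x, x ∈ Ioo a b → g₁ x = g₂ x := by
  have := isOpen_Ioo.ae_eq_zero_of_integral_contDiff_smul_eq_zero (U := Ioo a b) (μ := volume)
    (f := fun x => g₁ x - g₂ x) (h₁.2.1.sub h₂.2.1) (fun φ hφ hc hs => by
      have e1 := h₁.2.2 φ hφ hc hs
      have e2 := h₂.2.2 φ hφ hc hs
      have i1 := integrableOn_mul_of_tsupport_subset h₁.2.1 hφ.continuous hc hs
      have i2 := integrableOn_mul_of_tsupport_subset h₂.2.1 hφ.continuous hc hs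
      have e3 : ∫ x in Ioo a b, (g₁ x * φ x - g₂ x * φ x) = 0 := by
        rw [integral_sub i1 i2]; linarith
      rw [← setIntegral_eq_integral_of_forall_compl_eq_zero (s := Ioo a b), ← e3]
      · exact integral_congr_ae (.of_forall fun x => by simp only [smul_eq_mul]; ring)
      · intro x hx
        rw [image_eq_zero_of_notMem_tsupport fun hx' => hx (hs hx'), zero_smul])
  filter_upwards [this] with x hx hxm
  exact sub_eq_zero.1 (hx hxm)

/-- Weak derivatives agree almost everywhere, so all competitors in the infimum have the same
integral. -/
theorem h1NormSq_eq {f g : ℝ → ℝ} {a b : ℝ} (h : IsWeakDeriv a b f g) :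
    h1NormSq a b f = ∫⁻ x in Ioo a b, ENNReal.ofReal (f x ^ 2 + g x ^ 2) := by
  refine le_antisymm (iInf₂_le g h) (le_iInf₂ fun g' h' => le_of_eq ?_)
  refine lintegral_congr_ae ?_
  rw [EventuallyEq, ae_restrict_iff' measurableSet_Ioo]
  filter_upwards [h.ae_eq h'] with x hx hxm
  rw [hx hxm]

/-- The du Bois-Reymond lemma for continuous functions. -/
theorem exists_const_of_integral_mul_deriv_eq_zero {h : ℝ → ℝ} {a b : ℝ} (hab : a < b)
    (hh : ContinuousOn h (Ioo a b))
    (h0 : ∀ φ : ℝ → ℝ, ContDiff ℝ ∞ φ → HasCompactSupport φ → tsupport φ ⊆ Ioo a b →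
      ∫ x in Ioo a b, h x * deriv φ x = 0) : ∃ C, ∀ x ∈ Ioo a b, h x = C := by
  have hloc : LocallyIntegrableOn h (Ioo a b) := hh.locallyIntegrableOn measurableSet_Ioo
  obtain ⟨ψ, hψ, hψc, hψs, hψ1⟩ : ∃ ψ : ℝ → ℝ, ContDiff ℝ ∞ ψ ∧ HasCompactSupport ψ ∧
      tsupport ψ ⊆ Ioo a b ∧ ∫ x, ψ x = 1 := by
    let B : ContDiffBump ((a + b) / 2 : ℝ) :=
      ⟨(b - a) / 8, (b - a) / 4, by linarith, by linarith⟩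
    refine ⟨B.normed volume, B.contDiff_normed, B.hasCompactSupport_normed, ?_, B.integral_normed⟩
    rw [B.tsupport_normed_eq, Real.closedBall_eq_Icc]
    intro x hx
    have h1 : B.rOut = (b - a) / 4 := rfl
    rw [h1] at hx
    constructor <;> linarith [hx.1, hx.2]
  set C := ∫ x in Ioo a b, h x * ψ x
  have main : ∀ φ : ℝ → ℝ, ContDiff ℝ ∞ φ → HasCompactSupport φ → tsupport φ ⊆ Ioo a b →
      ∫ x in Ioo a b, h x * φ x = C * ∫ x, φ x := by
    intro φ hφ hφc hφs
    set m := ∫ x, φ x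
    obtain ⟨a₁, b₁, ha, hab', hb, hK⟩ := exists_Icc_of_compact_subset_Ioo hab
      (hφc.isCompact.union hψc.isCompact) (union_subset hφs hψs)
    let θ : ℝ → ℝ := fun x => φ x - m * ψ x
    have hθ : ContDiff ℝ ∞ θ := hφ.sub (contDiff_const.mul hψ)
    have hθ0 : ∀ x, x ∉ Icc a₁ b₁ → θ x = 0 := fun x hx => by
      have e1 : φ x = 0 := image_eq_zero_of_notMem_tsupport fun hx' => hx (hK (.inl hx'))
      have e2 : ψ x = 0 := image_eq_zero_of_notMem_tsupport fun hx' => hx (hK (.inr hx'))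
      simp [θ, e1, e2]
    -- Subtracting m ψ gives θ mean zero, so its primitive Φ has compact support and is itself a
    -- test function. Testing with Φ shows that h acts on φ like the constant C.
    have hφi : Integrable φ := hφ.continuous.integrable_of_hasCompactSupport hφc
    have hψi : Integrable ψ := hψ.continuous.integrable_of_hasCompactSupport hψc
    have hθi : ∫ x, θ x = 0 := by
      simp only [θ]
      rw [integral_sub hφi (hψi.const_mul m), integral_const_mul, hψ1, mul_one, sub_self]
    let Φ : ℝ → ℝ := fun x => ∫ y in a₁..x, θ y
    have hΦd : ∀ x, HasDerivAt Φ (θ x) x := fun x =>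
      intervalIntegral.integral_hasDerivAt_right (hθ.continuous.intervalIntegrable _ _)
        (hθ.continuous.stronglyMeasurableAtFilter _ _) hθ.continuous.continuousAt
    have hdΦ : deriv Φ = θ := funext fun x => (hΦd x).deriv
    have hΦ : ContDiff ℝ ∞ Φ :=
      contDiff_infty_iff_deriv.2 ⟨fun x => (hΦd x).differentiableAt, hdΦ ▸ hθ⟩
    have hΦ0 : ∀ x, x ∉ Icc a₁ b₁ → Φ x = 0 := by
      intro x hx
      rw [mem_Icc, not_and_or, not_le, not_le] at hx
      rcases hx with hx | hx
      · simp only [Φ]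
        rw [intervalIntegral.integral_symm, intervalIntegral.integral_of_le hx.le,
          integral_Ioc_eq_integral_Ioo, setIntegral_eq_zero_of_forall_eq_zero, neg_zero]
        intro y hy
        exact hθ0 y fun hy' => by linarith [hy.2, hy'.1]
      · simp only [Φ]
        rw [intervalIntegral.integral_of_le (hab'.trans hx.le), ← integral_Icc_eq_integral_Ioc,
          setIntegral_eq_integral_of_forall_compl_eq_zero, hθi]
        intro y hy
        exact hθ0 y fun hy' => hy ⟨hy'.1, hy'.2.trans hx.le⟩
    have hΦs : tsupport Φ ⊆ Icc a₁ b₁ :=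
      closure_minimal (fun x hx => by_contra fun hx' => hx (hΦ0 x hx')) isClosed_Icc
    have hΦc : HasCompactSupport Φ := HasCompactSupport.intro isCompact_Icc fun x hx => hΦ0 x hx
    have := h0 Φ hΦ hΦc (hΦs.trans fun x hx => ⟨ha.trans_le hx.1, hx.2.trans_lt hb⟩)
    rw [hdΦ] at this
    have i1 := integrableOn_mul_of_tsupport_subset hloc hφ.continuous hφc hφs
    have i2 := integrableOn_mul_of_tsupport_subset hloc hψ.continuous hψc hψs
    have e : ∫ x in Ioo a b, h x * θ x
        = (∫ x in Ioo a b, h x * φ x) - m * ∫ x in Ioo a b, h x * ψ x := by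
      rw [← integral_const_mul, ← integral_sub i1 (i2.const_mul m)]
      exact integral_congr_ae (.of_forall fun x => by simp only [θ]; ring)
    rw [e] at this
    linarith
  refine ⟨C, ?_⟩
  have hae := isOpen_Ioo.ae_eq_zero_of_integral_contDiff_smul_eq_zero (U := Ioo a b) (μ := volume)
    (f := fun x => h x - C) (hloc.sub (continuousOn_const.locallyIntegrableOn measurableSet_Ioo))
    (fun φ hφ hc hs => by
      have hφi : Integrable φ := hφ.continuous.integrable_of_hasCompactSupport hc
      have i1 := integrableOn_mul_of_tsupport_subset hloc hφ.continuous hc hs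
      have hz : ∀ x, x ∉ Ioo a b → φ x = 0 := fun x hx =>
        image_eq_zero_of_notMem_tsupport fun hx' => hx (hs hx')
      have e3 : ∫ x in Ioo a b, (h x * φ x - C * φ x) = 0 := by
        rw [integral_sub i1 (hφi.integrableOn.const_mul C), main φ hφ hc hs, integral_const_mul,
          setIntegral_eq_integral_of_forall_compl_eq_zero hz, sub_self]
      rw [← setIntegral_eq_integral_of_forall_compl_eq_zero (s := Ioo a b), ← e3]
      · exact integral_congr_ae (.of_forall fun x => by simp only [smul_eq_mul]; ring)
      · intro x hx
        rw [hz x hx, zero_smul])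
  have heq : EqOn h (fun _ => C) (Ioo a b) := by
    refine Measure.eqOn_open_of_ae_eq (μ := volume) ?_ isOpen_Ioo hh continuousOn_const
    rw [EventuallyEq, ae_restrict_iff' measurableSet_Ioo]
    filter_upwards [hae] with x hx hxm
    exact sub_eq_zero.1 (hx hxm)
  exact fun x hx => heq hx

/-- A continuous function is an indefinite integral of its weak derivative. -/
theorem IsWeakDeriv.sub_eq_integral {f g : ℝ → ℝ} {a b : ℝ} (h : IsWeakDeriv a b f g)
    (hf : ContinuousOn f (Ioo a b)) {x y : ℝ} (hx : x ∈ Ioo a b) (hy : y ∈ Ioo a b) :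
    f y - f x = ∫ z in x..y, g z := by
  have hab : a < b := hx.1.trans hx.2
  have hint : ∀ z ∈ Ioo a b, ∀ w ∈ Ioo a b, IntervalIntegrable g volume z w := fun z hz w hw => by
    rw [intervalIntegrable_iff]
    exact (h.2.1.integrableOn_compact_subset (ordConnected_Ioo.uIcc_subset hz hw)
      isCompact_uIcc).mono_set uIoc_subset_uIcc
  -- f and the primitive G share the weak derivative g, so f - G is constant by the du Bois-Reymond
  -- lemma.
  let G : ℝ → ℝ := fun z => ∫ w in x..z, g w
  have hG : ContinuousOn G (Ioo a b) := by
    intro z hz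
    obtain ⟨l, hl1, hl2⟩ := exists_between (lt_min hx.1 hz.1)
    obtain ⟨r, hr1, hr2⟩ := exists_between (max_lt hx.2 hz.2)
    have hl : l ∈ Ioo a b := ⟨hl1, (hl2.trans_le (min_le_left _ _)).trans hx.2⟩
    have hr : r ∈ Ioo a b := ⟨hx.1.trans ((le_max_left _ _).trans_lt hr1), hr2⟩
    have hlr : l ≤ r := ((hl2.trans_le (min_le_left _ _)).trans
      ((le_max_left _ _).trans_lt hr1)).le
    have hxm : x ∈ uIcc l r := by
      rw [uIcc_of_le hlr]
      exact ⟨(hl2.trans_le (min_le_left _ _)).le, ((le_max_left _ _).trans_lt hr1).le⟩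
    have := intervalIntegral.continuousOn_primitive_interval' (hint l hl r hr) hxm
    rw [uIcc_of_le hlr] at this
    exact (this.continuousAt (Icc_mem_nhds (hl2.trans_le (min_le_right _ _))
      ((le_max_right _ _).trans_lt hr1))).continuousWithinAt
  have hGsub : ∀ z ∈ Ioo a b, ∀ w ∈ Ioo a b, G w - G z = ∫ v in z..w, g v := fun z hz w hw =>
    intervalIntegral.integral_interval_sub_left (hint x hx w hw) (hint x hx z hz)
  have hw := isWeakDeriv_of_primitive hab hG h.2.1 fun z hz w hw _ => hGsub z hz w hw
  obtain ⟨C, hC⟩ := exists_const_of_integral_mul_deriv_eq_zero (h := fun z => f z - G z) hab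
    (hf.sub hG) (fun φ hφ hc hs => by
      have hdφ : Continuous (deriv φ) := hφ.continuous_deriv (by simp)
      have hs' : tsupport (deriv φ) ⊆ Ioo a b := tsupport_deriv_subset.trans hs
      have i1 := integrableOn_mul_of_tsupport_subset h.1 hdφ hc.deriv hs'
      have i2 := integrableOn_mul_of_tsupport_subset hw.1 hdφ hc.deriv hs'
      have e : ∫ z in Ioo a b, (f z - G z) * deriv φ z
          = (∫ z in Ioo a b, f z * deriv φ z) - ∫ z in Ioo a b, G z * deriv φ z := by
        rw [← integral_sub i1 i2]
        exact integral_congr_ae (.of_forall fun z => by simp only; ring)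
      rw [e, h.2.2 φ hφ hc hs, hw.2.2 φ hφ hc hs, sub_self])
  rw [← hGsub x hx y hy]
  linarith [hC x hx, hC y hy]

/-! ### One-sided extrema -/

theorem deriv_nonneg_of_left_min {f : ℝ → ℝ} {f' a b : ℝ} (hab : a < b)
    (hd : HasDerivWithinAt f f' (Icc a b) a) (hmin : ∀ x ∈ Icc a b, f a ≤ f x) : 0 ≤ f' := by
  rw [hasDerivWithinAt_iff_tendsto_slope, Icc_sdiff_left] at hd
  have : (𝓝[Ioc a b] a).NeBot := left_nhdsWithin_Ioc_neBot hab
  refine ge_of_tendsto hd (eventually_nhdsWithin_of_forall fun x hx => ?_)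
  rw [slope_def_field]
  exact div_nonneg (sub_nonneg.2 (hmin x (Ioc_subset_Icc_self hx))) (sub_nonneg.2 hx.1.le)

theorem deriv_nonpos_of_right_min {f : ℝ → ℝ} {f' a b : ℝ} (hab : a < b)
    (hd : HasDerivWithinAt f f' (Icc a b) b) (hmin : ∀ x ∈ Icc a b, f b ≤ f x) : f' ≤ 0 := by
  rw [hasDerivWithinAt_iff_tendsto_slope, Icc_sdiff_right] at hd
  have : (𝓝[Ico a b] b).NeBot := right_nhdsWithin_Ico_neBot hab
  refine le_of_tendsto hd (eventually_nhdsWithin_of_forall fun x hx => ?_)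
  rw [slope_def_field]
  exact div_nonpos_of_nonneg_of_nonpos (sub_nonneg.2 (hmin x (Ico_subset_Icc_self hx)))
    (sub_nonpos.2 hx.2.le)

/-- The second derivative is nonnegative at an interior minimum. -/
theorem second_deriv_nonneg_of_min {f f' : ℝ → ℝ} {f'' a b x : ℝ} (hx : x ∈ Ioo a b)
    (hf : ∀ y ∈ Ioo a b, HasDerivAt f (f' y) y) (hf' : HasDerivAt f' f'' x)
    (hmin : ∀ y ∈ Ioo a b, f x ≤ f y) : 0 ≤ f'' := by
  -- If f'' < 0, then f' < 0 just to the right of x, and the mean value theorem there contradicts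
  -- minimality.
  by_contra! hneg
  have h0 : f' x = 0 := IsLocalMin.hasDerivAt_eq_zero
    (Filter.eventually_of_mem (Ioo_mem_nhds hx.1 hx.2) hmin) (hf x hx)
  have h1 := (hasDerivAt_iff_tendsto_slope.1 hf').mono_left
    (nhdsWithin_mono x (fun y (hy : y ∈ Ioi x) => (ne_of_gt hy : y ≠ x)))
  have h2 : ∀ᶠ y in 𝓝[>] x, f' y < 0 := by
    filter_upwards [h1.eventually (gt_mem_nhds hneg), self_mem_nhdsWithin] with y hy hyx
    rw [slope_def_field, h0, sub_zero] at hy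
    exact (div_neg_iff.1 hy).resolve_left (fun h => by
      have : x < y := hyx
      linarith [h.2]) |>.1
  obtain ⟨c, hc, hcs⟩ := mem_nhdsGT_iff_exists_Ioo_subset.1
    (h2.and (Ioo_mem_nhdsGT hx.2))
  have hc' : x < c := hc
  obtain ⟨d, hd1, hd2⟩ := exists_between hc'
  have hdb : d ∈ Ioo x b := (hcs ⟨hd1, hd2⟩).2
  have hsub : ∀ y, x ≤ y → y ≤ d → y ∈ Ioo a b := fun y h1 h2 =>
    ⟨hx.1.trans_le h1, h2.trans_lt hdb.2⟩
  obtain ⟨e, he, hes⟩ := exists_hasDerivAt_eq_slope f f' hd1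
    (fun y hy => (hf y (hsub y hy.1 hy.2)).continuousAt.continuousWithinAt)
    (fun y hy => hf y (hsub y hy.1.le hy.2.le))
  have h3 : f' e < 0 := (hcs ⟨he.1, he.2.trans hd2⟩).1
  have h4 : 0 ≤ f' e := by
    rw [hes]
    exact div_nonneg (sub_nonneg.2 (hmin d (hsub d hd1.le le_rfl))) (sub_nonneg.2 hd1.le)
  linarith

/-! ### The heat equation on a moving interval -/

/-- A classical solution on `[0, τ]` of the heat equation `u_t = α u_xx` on the moving interval
`[0, s t]`, with `u = 0` and the Stefan condition `s' = -β u_x` at the moving end. -/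
structure MovingHeat (α β τ : ℝ) (s : ℝ → ℝ) (u ux uxx : ℝ → ℝ → ℝ) : Prop where
  alpha_pos : 0 < α
  beta_pos : 0 < β
  continuous_s : ContinuousOn s (Icc 0 τ)
  s_pos : ∀ t ∈ Icc 0 τ, 0 < s t
  continuous_u : ContinuousOn (fun p : ℝ × ℝ => u p.1 p.2)
    {p | p.2 ∈ Icc 0 τ ∧ p.1 ∈ Icc 0 (s p.2)}
  deriv_u : ∀ t ∈ Ioc 0 τ, ∀ x ∈ Icc 0 (s t),
    HasDerivWithinAt (fun y => u y t) (ux x t) (Icc 0 (s t)) x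
  continuous_ux : ContinuousOn (fun p : ℝ × ℝ => ux p.1 p.2)
    {p | p.2 ∈ Ioc 0 τ ∧ p.1 ∈ Icc 0 (s p.2)}
  deriv_ux : ∀ t ∈ Ioc 0 τ, ∀ x ∈ Icc 0 (s t),
    HasDerivWithinAt (fun y => ux y t) (uxx x t) (Icc 0 (s t)) x
  continuous_uxx : ContinuousOn (fun p : ℝ × ℝ => uxx p.1 p.2)
    {p | p.2 ∈ Ioc 0 τ ∧ p.1 ∈ Icc 0 (s p.2)}
  heat : ∀ t ∈ Ioc 0 τ, ∀ x, 0 < x → x < s t →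
    HasDerivAt (fun r => u x r) (α * uxx x t) t
  interface : ∀ t ∈ Icc 0 τ, u (s t) t = 0
  stefan : ∀ t ∈ Ioc 0 τ, HasDerivAt s (-β * ux (s t) t) t

namespace MovingHeat

variable {α β τ : ℝ} {s : ℝ → ℝ} {u ux uxx : ℝ → ℝ → ℝ}

theorem restrict (h : MovingHeat α β τ s u ux uxx) {τ' : ℝ} (hτ : τ' ≤ τ) :
    MovingHeat α β τ' s u ux uxx where
  alpha_pos := h.alpha_pos
  beta_pos := h.beta_pos
  continuous_s := h.continuous_s.mono (Icc_subset_Icc_right hτ)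
  s_pos t ht := h.s_pos t (Icc_subset_Icc_right hτ ht)
  continuous_u := h.continuous_u.mono fun _ hp => ⟨Icc_subset_Icc_right hτ hp.1, hp.2⟩
  deriv_u t ht := h.deriv_u t (Ioc_subset_Ioc_right hτ ht)
  continuous_ux := h.continuous_ux.mono fun _ hp => ⟨Ioc_subset_Ioc_right hτ hp.1, hp.2⟩
  deriv_ux t ht := h.deriv_ux t (Ioc_subset_Ioc_right hτ ht)
  continuous_uxx := h.continuous_uxx.mono fun _ hp => ⟨Ioc_subset_Ioc_right hτ hp.1, hp.2⟩
  heat t ht := h.heat t (Ioc_subset_Ioc_right hτ ht)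
  interface t ht := h.interface t (Icc_subset_Icc_right hτ ht)
  stefan t ht := h.stefan t (Ioc_subset_Ioc_right hτ ht)

/-- The barrier makes u a strict supersolution. Its slope -ε in x excludes a minimum at x = 0 and
its slope ε in t excludes one inside; at the interface and at time 0 the sum is positive because L
bounds s. -/
theorem add_barrier_pos (h : MovingHeat α β τ s u ux uxx) (h0 : ∀ x ∈ Icc 0 (s 0), 0 ≤ u x 0)
    (hflux : ∀ t ∈ Ioc 0 τ, ux 0 t ≤ 0) {L ε : ℝ} (hL : ∀ t ∈ Icc 0 τ, s t ≤ L) (hε : 0 < ε) :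
    ∀ t ∈ Icc 0 τ, ∀ x ∈ Icc 0 (s t), 0 < u x t + ε * (1 + t + L - x) := by
  intro t₁ ht₁ x₁ hx₁
  have hτ : 0 ≤ τ := ht₁.1.trans ht₁.2
  let W : ℝ → ℝ → ℝ := fun x t => u x t + ε * (1 + t + L - x)
  have hmaps : ∀ p ∈ Icc (0 : ℝ) 1 ×ˢ Icc 0 τ, (p.1 * s p.2) ∈ Icc 0 (s p.2) := fun p hp =>
    ⟨mul_nonneg hp.1.1 (h.s_pos _ hp.2).le, mul_le_of_le_one_left (h.s_pos _ hp.2).le hp.1.2⟩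
  have hs2 : ContinuousOn (fun p : ℝ × ℝ => s p.2) (Icc (0 : ℝ) 1 ×ˢ Icc 0 τ) :=
    h.continuous_s.comp continuousOn_snd fun p hp => hp.2
  have hmul : ContinuousOn (fun p : ℝ × ℝ => p.1 * s p.2) (Icc (0 : ℝ) 1 ×ˢ Icc 0 τ) :=
    continuousOn_fst.mul hs2
  have hcont : ContinuousOn (fun p : ℝ × ℝ => W (p.1 * s p.2) p.2)
      (Icc (0 : ℝ) 1 ×ˢ Icc 0 τ) := by
    refine ContinuousOn.add ?_ ?_
    · exact h.continuous_u.comp (hmul.prodMk continuousOn_snd)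
        fun p hp => ⟨hp.2, hmaps p hp⟩
    · exact continuousOn_const.mul (((continuousOn_const.add continuousOn_snd).add
        continuousOn_const).sub hmul)
  -- The substitution x = y s(t) carries the moving domain to a fixed compact rectangle, where the
  -- minimum is attained.
  obtain ⟨⟨y, t⟩, ⟨hy, ht⟩, hmin⟩ := (isCompact_Icc.prod isCompact_Icc).exists_isMinOn
    ⟨((0 : ℝ), (0 : ℝ)), ⟨by simp, ⟨le_rfl, hτ⟩⟩⟩ hcont
  simp only at hy ht
  have hx := hmaps (y, t) ⟨hy, ht⟩
  simp only at hx
  set x := y * s t with hxdef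
  have hWmin : ∀ t' ∈ Icc 0 τ, ∀ x' ∈ Icc 0 (s t'), W x t ≤ W x' t' := by
    intro t' ht' x' hx'
    have hp := h.s_pos t' ht'
    have := hmin (a := (x' / s t', t')) ⟨⟨div_nonneg hx'.1 hp.le, (div_le_one hp).2 hx'.2⟩, ht'⟩
    simpa [div_mul_cancel₀ _ hp.ne', ← hxdef] using this
  suffices hW : 0 < W x t from hW.trans_le (hWmin t₁ ht₁ x₁ hx₁)
  have hbar : 0 < ε * (1 + t + L - x) := by
    have := hL t ht
    exact mul_pos hε (by linarith [hx.2, ht.1])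
  rcases hx.2.eq_or_lt with hxs | hxs
  · have : u x t = 0 := by rw [hxs]; exact h.interface t ht
    simp only [W, this, zero_add]
    exact hbar
  rcases ht.1.eq_or_lt with ht0 | ht0
  · have : 0 ≤ u x t := by
      rw [← ht0]
      exact h0 x ⟨hx.1, by rw [ht0]; exact hx.2⟩
    simp only [W]
    linarith
  exfalso
  have ht' : t ∈ Ioc 0 τ := ⟨ht0, ht.2⟩
  have hdW : ∀ y ∈ Icc 0 (s t), HasDerivWithinAt (fun y => W y t) (ux y t - ε) (Icc 0 (s t)) y := by
    intro y hy
    have h1 : HasDerivAt (fun y : ℝ => ε * (1 + t + L - y)) (ε * (0 - 1)) y :=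
      ((hasDerivAt_const y _).sub (hasDerivAt_id y)).const_mul ε
    convert! (h.deriv_u t ht' y hy).add h1.hasDerivWithinAt using 1
    ring
  rcases hx.1.eq_or_lt with hx0 | hx0
  · have := deriv_nonneg_of_left_min (h.s_pos t ht) (hdW 0 ⟨le_rfl, (h.s_pos t ht).le⟩)
      (fun z hz => by simpa only [← hx0] using hWmin t ht z hz)
    linarith [hflux t ht']
  · have hI : ∀ z ∈ Ioo 0 (s t), Icc 0 (s t) ∈ 𝓝 z := fun z hz => Icc_mem_nhds hz.1 hz.2
    have hxx : 0 ≤ uxx x t := by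
      have hd2 : HasDerivAt (fun z => ux z t - ε) (uxx x t) x :=
        ((h.deriv_ux t ht' x hx).hasDerivAt (hI x ⟨hx0, hxs⟩)).sub_const ε
      exact second_deriv_nonneg_of_min (a := 0) (b := s t) ⟨hx0, hxs⟩
        (fun z hz => (hdW z (Ioo_subset_Icc_self hz)).hasDerivAt (hI z hz)) hd2
        fun z hz => hWmin t ht z (Ioo_subset_Icc_self hz)
    have hdt : HasDerivAt (fun r => W x r) (α * uxx x t + ε) t := by
      have h1 : HasDerivAt (fun r : ℝ => ε * (1 + r + L - x)) (ε * 1) t :=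
        ((((hasDerivAt_id t).const_add 1).add_const L).sub_const x).const_mul ε
      convert! (h.heat t ht' x hx0 hxs).add h1 using 1
      ring
    -- Comparison with slightly earlier times suffices and also covers t = τ. Monotonicity of s is
    -- not yet available; continuity keeps x inside the liquid at those times.
    have hev : ∀ᶠ r in 𝓝[<] t, r ∈ Icc 0 τ ∧ x < s r := by
      have h1 : ContinuousWithinAt s (Icc 0 τ) t := h.continuous_s t ht
      have h2 : ∀ᶠ r in 𝓝[Icc 0 τ] t, x < s r := h1.eventually (lt_mem_nhds hxs)
      have h3 : 𝓝[<] t ≤ 𝓝[Icc 0 τ] t := by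
        rw [← nhdsWithin_Ico_eq_nhdsLT ht0]
        exact nhdsWithin_mono _ fun r hr => ⟨hr.1, hr.2.le.trans ht.2⟩
      have h4 : ∀ᶠ r in 𝓝[<] t, r ∈ Icc 0 τ := h3 self_mem_nhdsWithin
      exact h4.and (h2.filter_mono h3)
    obtain ⟨l, hl, hls⟩ := mem_nhdsLT_iff_exists_Ioo_subset.1 hev
    have hl' : l < t := hl
    obtain ⟨m, hm1, hm2⟩ := exists_between hl'
    have hle := deriv_nonpos_of_right_min hm2 hdt.hasDerivWithinAt (fun r hr => by
      rcases hr.2.eq_or_lt with rfl | hr2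
      · exact le_rfl
      · have := hls ⟨hm1.trans_le hr.1, hr2⟩
        exact hWmin r this.1 x ⟨hx.1, this.2.le⟩)
    have := mul_nonneg h.alpha_pos.le hxx
    linarith

/-- The maximum principle with heating flux at the fixed end. -/
theorem nonneg (h : MovingHeat α β τ s u ux uxx) (h0 : ∀ x ∈ Icc 0 (s 0), 0 ≤ u x 0)
    (hflux : ∀ t ∈ Ioc 0 τ, ux 0 t ≤ 0) : ∀ t ∈ Icc 0 τ, ∀ x ∈ Icc 0 (s t), 0 ≤ u x t := by
  intro t ht x hx
  obtain ⟨L, hL⟩ := (isCompact_Icc.image_of_continuousOn h.continuous_s).bddAbove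
  have hL' : ∀ t ∈ Icc 0 τ, s t ≤ L := fun t ht => hL (mem_image_of_mem s ht)
  by_contra! hneg
  have hK : 0 < 1 + t + L - x := by linarith [hL' t ht, hx.2, ht.1]
  -- This ε makes the perturbed function vanish exactly at the supposed negative point.
  have := h.add_barrier_pos h0 hflux hL' (div_pos (neg_pos.2 hneg) hK) t ht x hx
  rw [div_mul_cancel₀ _ hK.ne'] at this
  linarith

theorem ux_interface_nonpos (h : MovingHeat α β τ s u ux uxx)
    (hu : ∀ t ∈ Icc 0 τ, ∀ x ∈ Icc 0 (s t), 0 ≤ u x t) : ∀ t ∈ Ioc 0 τ, ux (s t) t ≤ 0 := by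
  intro t ht
  have ht' := Ioc_subset_Icc_self ht
  refine deriv_nonpos_of_right_min (h.s_pos t ht')
    (h.deriv_u t ht _ (right_mem_Icc.2 (h.s_pos t ht').le)) fun x hx => ?_
  rw [h.interface t ht']
  exact hu t ht' x hx

theorem monotoneOn_s (h : MovingHeat α β τ s u ux uxx)
    (hx : ∀ t ∈ Ioc 0 τ, ux (s t) t ≤ 0) : MonotoneOn s (Icc 0 τ) := by
  refine monotoneOn_of_deriv_nonneg (convex_Icc _ _) h.continuous_s ?_ ?_ <;>
    rw [interior_Icc] <;> intro t ht
  · exact (h.stefan t (Ioo_subset_Ioc_self ht)).differentiableAt.differentiableWithinAt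
  · rw [(h.stefan t (Ioo_subset_Ioc_self ht)).deriv]
    nlinarith [hx t (Ioo_subset_Ioc_self ht), h.beta_pos]

end MovingHeat

/-! ### Integrals over expanding intervals -/

/-- The derivative of the integral over a thin strip with a moving upper end. -/
theorem hasDerivWithinAt_integral_strip {s : ℝ → ℝ} {G : ℝ → ℝ → ℝ} {t τ s' : ℝ} (htτ : t < τ)
    (hmono : MonotoneOn s (Icc t τ)) (hs : HasDerivAt s s' t)
    (hcs : ContinuousOn s (Icc t τ)) (hs0 : 0 ≤ s t)
    (hG : ContinuousOn (fun p : ℝ × ℝ => G p.1 p.2) {p | p.2 ∈ Icc t τ ∧ p.1 ∈ Icc 0 (s p.2)}) :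
    HasDerivWithinAt (fun r => ∫ x in (s t)..(s r), G x r) (s' * G (s t) t) (Ici t) t := by
  have htI : t ∈ Icc t τ := left_mem_Icc.2 htτ.le
  have hst : ∀ r ∈ Icc t τ, s t ≤ s r := fun r hr => hmono htI hr hr.1
  have hfilter : 𝓝[≥] t = 𝓝[Icc t τ] t := (nhdsWithin_Icc_eq_nhdsGE htτ).symm
  have hgi : ∀ r ∈ Icc t τ, IntervalIntegrable (fun x => G x r) volume (s t) (s r) := by
    intro r hr
    refine ContinuousOn.intervalIntegrable ?_
    rw [uIcc_of_le (hst r hr)]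
    exact hG.comp (continuousOn_id.prodMk continuousOn_const)
      fun x hx => ⟨hr, hs0.trans hx.1, hx.2⟩
  have hlo : HasDerivWithinAt
      (fun r => (∫ x in (s t)..(s r), G x r) - (s r - s t) * G (s t) t) 0 (Ici t) t := by
    rw [hasDerivWithinAt_iff_isLittleO]
    simp only [sub_self, intervalIntegral.integral_same, zero_mul, sub_zero, smul_zero]
    -- The strip has width O(r - t), and by continuity G differs from its corner value by at most ε
    -- on it.
    refine Asymptotics.IsLittleO.trans_isBigO (g := fun r => s r - s t) ?_
      (hs.isBigO_sub.mono nhdsWithin_le_nhds)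
    rw [Asymptotics.isLittleO_iff]
    intro ε hε
    have h1 := hG (s t, t) ⟨htI, hs0, le_rfl⟩
    rw [ContinuousWithinAt, Metric.tendsto_nhdsWithin_nhds] at h1
    obtain ⟨δ, hδ, hδ'⟩ := h1 ε hε
    have h2 : ∀ᶠ r in 𝓝[Icc t τ] t, dist (s r) (s t) < δ :=
      (hcs t htI).eventually (Metric.ball_mem_nhds _ hδ)
    have h3 : ∀ᶠ r in 𝓝[Icc t τ] t, dist r t < δ :=
      nhdsWithin_le_nhds (Metric.ball_mem_nhds _ hδ)
    rw [hfilter]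
    filter_upwards [h2, h3, self_mem_nhdsWithin] with r hr1 hr2 hr3
    have e : (∫ x in (s t)..(s r), G x r) - (s r - s t) * G (s t) t
        = ∫ x in (s t)..(s r), (G x r - G (s t) t) := by
      rw [intervalIntegral.integral_sub (hgi r hr3) (by simp)]
      simp
    rw [e, Real.norm_eq_abs (s r - s t)]
    refine intervalIntegral.norm_integral_le_of_norm_le_const fun x hx => ?_
    rw [uIoc_of_le (hst r hr3)] at hx
    have := hδ' (x := (x, r)) ⟨hr3, hs0.trans hx.1.le, hx.2⟩ (by
      rw [Prod.dist_eq]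
      refine max_lt ?_ hr2
      simp only
      rw [Real.dist_eq, abs_of_pos (sub_pos.2 hx.1)]
      rw [Real.dist_eq, abs_of_nonneg (sub_nonneg.2 (hst r hr3))] at hr1
      linarith [hx.2])
    rw [← dist_eq_norm]
    exact this.le
  have h4 : HasDerivWithinAt (fun r => (s r - s t) * G (s t) t) (s' * G (s t) t) (Ici t) t :=
    ((hs.sub_const (s t)).mul_const _).hasDerivWithinAt
  convert! hlo.add h4 using 1
  · ext r; simp
  · ring

/-- The difference quotient at t is Ψ itself, so continuity of Ψ is enough. -/
theorem hasDerivWithinAt_sub_mul {Ψ : ℝ → ℝ} {t τ : ℝ} (htτ : t < τ)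
    (hΨ : ContinuousOn Ψ (Icc t τ)) :
    HasDerivWithinAt (fun r => (r - t) * Ψ r) (Ψ t) (Ici t) t := by
  rw [hasDerivWithinAt_iff_tendsto_slope, Ici_sdiff_left]
  have h1 : Tendsto Ψ (𝓝[>] t) (𝓝 (Ψ t)) := by
    refine (hΨ t (left_mem_Icc.2 htτ.le)).mono_left ?_
    rw [← nhdsWithin_Ioc_eq_nhdsGT htτ]
    exact nhdsWithin_mono _ Ioc_subset_Icc_self
  refine h1.congr' ?_
  filter_upwards [self_mem_nhdsWithin] with r hr
  have : r - t ≠ 0 := (sub_pos.2 hr).ne'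
  rw [slope_def_field]
  field_simp
  ring

/-- Leibniz' rule for an integral over an expanding interval, with a right derivative. -/
theorem hasDerivWithinAt_integral_expanding {s : ℝ → ℝ} {G : ℝ → ℝ → ℝ} {Ψ : ℝ → ℝ} {t τ s' : ℝ}
    (htτ : t < τ) (hmono : MonotoneOn s (Icc t τ)) (hs : HasDerivAt s s' t)
    (hcs : ContinuousOn s (Icc t τ)) (hs0 : 0 ≤ s t)
    (hG : ContinuousOn (fun p : ℝ × ℝ => G p.1 p.2) {p | p.2 ∈ Icc t τ ∧ p.1 ∈ Icc 0 (s p.2)})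
    (hΨ : ContinuousOn Ψ (Icc t τ))
    (hinc : ∀ r ∈ Icc t τ, ∫ x in (0 : ℝ)..(s t), (G x r - G x t) = (r - t) * Ψ r) :
    HasDerivWithinAt (fun r => ∫ x in (0 : ℝ)..(s r), G x r) (Ψ t + s' * G (s t) t)
      (Ici t) t := by
  have htI : t ∈ Icc t τ := left_mem_Icc.2 htτ.le
  have hst : ∀ r ∈ Icc t τ, s t ≤ s r := fun r hr => hmono htI hr hr.1
  have hfilter : 𝓝[≥] t = 𝓝[Icc t τ] t := (nhdsWithin_Icc_eq_nhdsGE htτ).symm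
  have hgi : ∀ r ∈ Icc t τ, ∀ l ∈ Icc 0 (s r), ∀ m ∈ Icc 0 (s r),
      IntervalIntegrable (fun x => G x r) volume l m := by
    intro r hr l hl m hm
    refine ContinuousOn.intervalIntegrable ?_
    exact hG.comp (continuousOn_id.prodMk continuousOn_const)
      fun x hx => ⟨hr, ordConnected_Icc.uIcc_subset hl hm hx⟩
  have hΨd := hasDerivWithinAt_sub_mul htτ hΨ
  have hstrip := hasDerivWithinAt_integral_strip htτ hmono hs hcs hs0 hG
  have hsum := (hΨd.add hstrip).const_add (∫ x in (0 : ℝ)..(s t), G x t)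
  refine hsum.congr_of_eventuallyEq ?_ (by simp)
  rw [hfilter]
  filter_upwards [self_mem_nhdsWithin] with r hr
  have hr0 : (0 : ℝ) ∈ Icc 0 (s r) := ⟨le_rfl, hs0.trans (hst r hr)⟩
  have hrt : s t ∈ Icc 0 (s r) := ⟨hs0, hst r hr⟩
  have hrr : s r ∈ Icc 0 (s r) := ⟨hr0.2, le_rfl⟩
  have h1 := hinc r hr
  rw [intervalIntegral.integral_sub (hgi r hr _ hr0 _ hrt)
    (hgi t htI _ ⟨le_rfl, hs0⟩ _ ⟨hs0, le_rfl⟩)] at h1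
  have h2 := intervalIntegral.integral_add_adjacent_intervals (hgi r hr _ hr0 _ hrt)
    (hgi r hr _ hrt _ hrr)
  simp only [Pi.add_apply]
  linarith

/-- An integral over `[0, s t]` depends continuously on `t`. -/
theorem continuousOn_integral_moving {s : ℝ → ℝ} {G : ℝ → ℝ → ℝ} {a b : ℝ} (hab : a ≤ b)
    (hs : ContinuousOn s (Icc a b)) (hs0 : ∀ t ∈ Icc a b, 0 ≤ s t)
    (hG : ContinuousOn (fun p : ℝ × ℝ => G p.1 p.2) {p | p.2 ∈ Icc a b ∧ p.1 ∈ Icc 0 (s p.2)}) :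
    ContinuousOn (fun t => ∫ x in (0 : ℝ)..(s t), G x t) (Icc a b) := by
  -- Rescaling x = y s(t) fixes the interval of integration.
  have hs2 : ContinuousOn (fun p : ℝ × ℝ => p.1 * s p.2) (Icc (0 : ℝ) 1 ×ˢ Icc a b) :=
    continuousOn_fst.mul (hs.comp continuousOn_snd fun p hp => hp.2)
  have h1 : ContinuousOn (fun t => ∫ y in (0 : ℝ)..1, G (y * s t) t) (Icc a b) :=
    continuousOn_parametric_integral (G := fun y t => G (y * s t) t) zero_le_one hab
      (hG.comp (hs2.prodMk continuousOn_snd) fun p hp =>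
        ⟨hp.2, mul_nonneg hp.1.1 (hs0 _ hp.2), mul_le_of_le_one_left (hs0 _ hp.2) hp.1.2⟩)
  refine (hs.mul h1).congr fun t _ => ?_
  have := intervalIntegral.smul_integral_comp_mul_right (a := 0) (b := 1) (fun x => G x t) (s t)
  simpa using this.symm

/-! ### Time increments of the temperature and derivatives of its space integrals -/

namespace MovingHeat

variable {α β τ : ℝ} {s : ℝ → ℝ} {u ux uxx : ℝ → ℝ → ℝ}

/-- The time difference quotient, continued by `α u_xx` to `r = t`. -/
def timeQuotient (α : ℝ) (uxx : ℝ → ℝ → ℝ) (t x r : ℝ) : ℝ :=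
  ∫ θ in (0 : ℝ)..1, α * uxx x (t + θ * (r - t))

theorem timeQuotient_self (α : ℝ) (uxx : ℝ → ℝ → ℝ) (t x : ℝ) :
    timeQuotient α uxx t x t = α * uxx x t := by
  simp [timeQuotient]

/-- Since the interface does not retreat, a point that is liquid at time t stays liquid. This is why
time derivatives of space integrals are taken from the right. -/
theorem mem_domain (hmono : MonotoneOn s (Icc 0 τ)) {t r x : ℝ} (ht : t ∈ Ioc 0 τ)
    (hr : r ∈ Icc t τ) (hx : x ∈ Icc 0 (s t)) :
    ((x, r) : ℝ × ℝ) ∈ {p : ℝ × ℝ | p.2 ∈ Ioc 0 τ ∧ p.1 ∈ Icc 0 (s p.2)} :=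
  ⟨⟨ht.1.trans_le hr.1, hr.2⟩, hx.1,
    hx.2.trans (hmono ⟨ht.1.le, ht.2⟩ ⟨ht.1.le.trans hr.1, hr.2⟩ hr.1)⟩

/-- Averaging u_xx over time gives a quotient that is jointly continuous up to r = t and up to both
ends in x, as differentiation under the integral requires. -/
theorem continuousOn_timeQuotient (h : MovingHeat α β τ s u ux uxx)
    (hmono : MonotoneOn s (Icc 0 τ)) {t : ℝ} (ht : t ∈ Ioc 0 τ) :
    ContinuousOn (fun p : ℝ × ℝ => timeQuotient α uxx t p.1 p.2) (Icc 0 (s t) ×ˢ Icc t τ) := by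
  have hs0 : 0 ≤ s t := (h.s_pos t (Ioc_subset_Icc_self ht)).le
  refine continuousOn_integral_of_retract (K := Icc 0 (s t) ×ˢ Icc t τ)
    (G := fun p θ => α * uxx p.1 (t + θ * (p.2 - t)))
    (ρ := fun p : ℝ × ℝ => ((projIcc 0 (s t) hs0 p.1 : ℝ), (projIcc t τ ht.2 p.2 : ℝ)))
    ?_ (fun p => ⟨(projIcc 0 (s t) hs0 p.1).2, (projIcc t τ ht.2 p.2).2⟩)
    (fun p hp => by simp only [projIcc_of_mem hs0 hp.1, projIcc_of_mem ht.2 hp.2])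
    zero_le_one ?_
  · exact (continuous_subtype_val.comp (continuous_projIcc.comp continuous_fst)).prodMk
      (continuous_subtype_val.comp (continuous_projIcc.comp continuous_snd))
  · refine continuousOn_const.mul (h.continuous_uxx.comp (f := fun q : (ℝ × ℝ) × ℝ =>
      (q.1.1, t + q.2 * (q.1.2 - t))) (Continuous.continuousOn (by fun_prop)) fun q hq => ?_)
    refine mem_domain (r := t + q.2 * (q.1.2 - t)) hmono ht ⟨?_, ?_⟩ hq.1.1
    · nlinarith [hq.2.1, hq.1.2.1, mul_nonneg hq.2.1 (sub_nonneg.2 hq.1.2.1)]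
    · nlinarith [hq.1.2.2, mul_le_of_le_one_left (sub_nonneg.2 hq.1.2.1) hq.2.2]

/-- Inside the liquid this is the heat equation integrated in time. Both sides are continuous in x,
so it persists at x = 0 and x = s(t), where the heat equation is not assumed. -/
theorem sub_eq_timeQuotient (h : MovingHeat α β τ s u ux uxx)
    (hmono : MonotoneOn s (Icc 0 τ)) {t r x : ℝ} (ht : t ∈ Ioc 0 τ) (hr : r ∈ Icc t τ)
    (hx : x ∈ Icc 0 (s t)) : u x r - u x t = (r - t) * timeQuotient α uxx t x r := by
  have hs0 : 0 < s t := h.s_pos t (Ioc_subset_Icc_self ht)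
  have huc : ∀ r ∈ Icc t τ, ContinuousOn (fun x => u x r) (Icc 0 (s t)) := fun r hr =>
    h.continuous_u.comp (continuousOn_id.prodMk continuousOn_const) fun x hx =>
      ⟨⟨ht.1.le.trans hr.1, hr.2⟩, (mem_domain hmono ht hr hx).2⟩
  have hΔ : ContinuousOn (fun x => (r - t) * timeQuotient α uxx t x r) (Icc 0 (s t)) :=
    continuousOn_const.mul ((h.continuousOn_timeQuotient hmono ht).comp
      (continuousOn_id.prodMk continuousOn_const) fun x hx => ⟨hx, hr⟩)
  have hEq : EqOn (fun x => u x r - u x t) (fun x => (r - t) * timeQuotient α uxx t x r)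
      (Ioo 0 (s t)) := by
    intro x hx
    have hxI := Ioo_subset_Icc_self hx
    have h1 := intervalIntegral.smul_integral_comp_add_mul (a := 0) (b := 1)
      (fun θ => α * uxx x θ) (r - t) t
    simp only [mul_zero, add_zero, mul_one, add_sub_cancel, smul_eq_mul] at h1
    have h2 : ∫ θ in t..r, α * uxx x θ = u x r - u x t := by
      refine intervalIntegral.integral_eq_sub_of_hasDerivAt (f := fun θ => u x θ)
        (fun θ hθ => ?_) ?_
      · rw [uIcc_of_le hr.1] at hθ
        have hd := mem_domain hmono ht ⟨hθ.1, hθ.2.trans hr.2⟩ hxI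
        exact h.heat θ hd.1 x hx.1 (hx.2.trans_le
          (hmono (Ioc_subset_Icc_self ht) (Ioc_subset_Icc_self hd.1) hθ.1))
      · refine ContinuousOn.intervalIntegrable ?_
        rw [uIcc_of_le hr.1]
        exact continuousOn_const.mul (h.continuous_uxx.comp
          (continuousOn_const.prodMk continuousOn_id)
          fun θ hθ => mem_domain hmono ht ⟨hθ.1, hθ.2.trans hr.2⟩ hxI)
    simp only
    rw [← h2, ← h1, timeQuotient]
    congr 1
    refine intervalIntegral.integral_congr fun θ _ => ?_
    rw [mul_comm θ]
  exact hEq.of_subset_closure ((huc r hr).sub (huc t ⟨le_rfl, ht.2⟩)) hΔ Ioo_subset_Icc_self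
    (by rw [closure_Ioo hs0.ne]) hx

end MovingHeat

namespace MovingHeat

variable {α β τ : ℝ} {s : ℝ → ℝ} {u ux uxx : ℝ → ℝ → ℝ}

theorem continuousOn_slice {G : ℝ → ℝ → ℝ} {J : Set ℝ}
    (hG : ContinuousOn (fun p : ℝ × ℝ => G p.1 p.2) {p | p.2 ∈ J ∧ p.1 ∈ Icc 0 (s p.2)})
    {r : ℝ} (hr : r ∈ J) : ContinuousOn (fun x => G x r) (Icc 0 (s r)) :=
  hG.comp (continuousOn_id.prodMk continuousOn_const) fun _ hx => ⟨hr, hx⟩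

theorem continuousOn_box {G : ℝ → ℝ → ℝ} (hmono : MonotoneOn s (Icc 0 τ)) {t : ℝ}
    (ht : t ∈ Ioc 0 τ)
    (hG : ContinuousOn (fun p : ℝ × ℝ => G p.1 p.2) {p | p.2 ∈ Ioc 0 τ ∧ p.1 ∈ Icc 0 (s p.2)}) :
    ContinuousOn (fun p : ℝ × ℝ => G p.1 p.2) (Icc 0 (s t) ×ˢ Icc t τ) :=
  hG.mono fun _ hp => mem_domain hmono ht hp.2 hp.1

theorem continuousOn_box_const {G : ℝ → ℝ → ℝ} {t : ℝ} (ht : t ∈ Ioc 0 τ)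
    (hG : ContinuousOn (fun p : ℝ × ℝ => G p.1 p.2) {p | p.2 ∈ Ioc 0 τ ∧ p.1 ∈ Icc 0 (s p.2)}) :
    ContinuousOn (fun p : ℝ × ℝ => G p.1 t) (Icc 0 (s t) ×ˢ Icc t τ) :=
  (continuousOn_slice hG ht).comp continuousOn_fst fun _ hp => hp.1

theorem continuous_u' (h : MovingHeat α β τ s u ux uxx) :
    ContinuousOn (fun p : ℝ × ℝ => u p.1 p.2) {p | p.2 ∈ Ioc 0 τ ∧ p.1 ∈ Icc 0 (s p.2)} :=
  h.continuous_u.mono fun _ hp => ⟨Ioc_subset_Icc_self hp.1, hp.2⟩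

/-- The time increment at a fixed point, including the two ends. -/
theorem sub_eq_integral (h : MovingHeat α β τ s u ux uxx)
    (hmono : MonotoneOn s (Icc 0 τ)) {t r x : ℝ} (ht : t ∈ Ioc 0 τ) (hr : r ∈ Icc t τ)
    (hx : x ∈ Icc 0 (s t)) : u x r - u x t = ∫ θ in t..r, α * uxx x θ := by
  rw [h.sub_eq_timeQuotient hmono ht hr hx, timeQuotient]
  have h1 := intervalIntegral.smul_integral_comp_add_mul (a := 0) (b := 1)
    (fun θ => α * uxx x θ) (r - t) t
  simp only [mul_zero, add_zero, mul_one, add_sub_cancel, smul_eq_mul] at h1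
  rw [← h1]
  congr 1
  refine intervalIntegral.integral_congr fun θ _ => ?_
  rw [mul_comm θ]

theorem integral_ux (h : MovingHeat α β τ s u ux uxx) {r a b : ℝ} (hr : r ∈ Ioc 0 τ) (ha : 0 ≤ a)
    (hab : a ≤ b) (hb : b ≤ s r) : ∫ x in a..b, ux x r = u b r - u a r := by
  have hsub : Icc a b ⊆ Icc 0 (s r) := Icc_subset_Icc ha hb
  refine intervalIntegral.integral_eq_sub_of_hasDerivAt_of_le (f := fun x => u x r) hab
    ((continuousOn_slice h.continuous_u' hr).mono hsub) (fun x hx => ?_) ?_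
  · exact (h.deriv_u r hr x (hsub (Ioo_subset_Icc_self hx))).hasDerivAt
      (Icc_mem_nhds (ha.trans_lt hx.1) (hx.2.trans_le hb))
  · refine ContinuousOn.intervalIntegrable ?_
    rw [uIcc_of_le hab]
    exact (continuousOn_slice h.continuous_ux hr).mono hsub

theorem integral_uxx (h : MovingHeat α β τ s u ux uxx) {r : ℝ} (hr : r ∈ Ioc 0 τ) :
    ∫ x in (0 : ℝ)..(s r), uxx x r = ux (s r) r - ux 0 r := by
  have hs0 := (h.s_pos r (Ioc_subset_Icc_self hr)).le
  refine intervalIntegral.integral_eq_sub_of_hasDerivAt_of_le (f := fun x => ux x r) hs0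
    (continuousOn_slice h.continuous_ux hr) (fun x hx => ?_) ?_
  · exact (h.deriv_ux r hr x (Ioo_subset_Icc_self hx)).hasDerivAt (Icc_mem_nhds hx.1 hx.2)
  · refine ContinuousOn.intervalIntegrable ?_
    rw [uIcc_of_le hs0]
    exact continuousOn_slice h.continuous_uxx hr

theorem integral_u_mul_uxx (h : MovingHeat α β τ s u ux uxx) {r : ℝ} (hr : r ∈ Ioc 0 τ) :
    ∫ x in (0 : ℝ)..(s r), u x r * uxx x r
      = -(u 0 r * ux 0 r) - ∫ x in (0 : ℝ)..(s r), ux x r ^ 2 := by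
  have hrI := Ioc_subset_Icc_self hr
  have hs0 := (h.s_pos r hrI).le
  have c0 := continuousOn_slice h.continuous_u' hr
  have c1 := continuousOn_slice h.continuous_ux hr
  have c2 := continuousOn_slice h.continuous_uxx hr
  have i1 : IntervalIntegrable (fun x => u x r * uxx x r) volume 0 (s r) :=
    ContinuousOn.intervalIntegrable (by rw [uIcc_of_le hs0]; exact c0.mul c2)
  have i2 : IntervalIntegrable (fun x => ux x r ^ 2) volume 0 (s r) :=
    ContinuousOn.intervalIntegrable (by rw [uIcc_of_le hs0]; exact c1.pow 2)
  have key : ∫ x in (0 : ℝ)..(s r), (u x r * uxx x r + ux x r ^ 2)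
      = u (s r) r * ux (s r) r - u 0 r * ux 0 r := by
    refine intervalIntegral.integral_eq_sub_of_hasDerivAt_of_le (f := fun x => u x r * ux x r) hs0
      (c0.mul c1) (fun x hx => ?_) (i1.add i2)
    have hN := Icc_mem_nhds hx.1 hx.2
    convert! ((h.deriv_u r hr x (Ioo_subset_Icc_self hx)).hasDerivAt hN).mul
      ((h.deriv_ux r hr x (Ioo_subset_Icc_self hx)).hasDerivAt hN) using 1
    ring
  rw [intervalIntegral.integral_add i1 i2, h.interface r hrI] at key
  linarith

/-- Heat balance, before inserting the flux at the fixed end. -/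
theorem hasDerivWithinAt_integral_u (h : MovingHeat α β τ s u ux uxx)
    (hmono : MonotoneOn s (Icc 0 τ)) {t : ℝ} (ht : t ∈ Ioo 0 τ) :
    HasDerivWithinAt (fun r => ∫ x in (0 : ℝ)..(s r), u x r) (α * (ux (s t) t - ux 0 t))
      (Ici t) t := by
  have ht' := Ioo_subset_Ioc_self ht
  have hsub : Icc t τ ⊆ Icc 0 τ := Icc_subset_Icc_left ht.1.le
  have hs0 := (h.s_pos t (Ioo_subset_Icc_self ht)).le
  have := hasDerivWithinAt_integral_expanding (G := u)
    (Ψ := fun r => ∫ x in (0 : ℝ)..(s t), timeQuotient α uxx t x r) ht.2 (hmono.mono hsub)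
    (h.stefan t ht') (h.continuous_s.mono hsub) hs0
    (h.continuous_u.mono fun p hp => ⟨hsub hp.1, hp.2⟩)
    (continuousOn_parametric_integral hs0 ht.2.le (h.continuousOn_timeQuotient hmono ht'))
    (fun r hr => by
      rw [← intervalIntegral.integral_const_mul]
      refine intervalIntegral.integral_congr fun x hx => ?_
      rw [uIcc_of_le hs0] at hx
      exact h.sub_eq_timeQuotient hmono ht' hr hx)
  convert! this using 1
  simp only [timeQuotient_self]
  rw [intervalIntegral.integral_const_mul, h.integral_uxx ht',
    h.interface t (Ioo_subset_Icc_self ht)]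
  ring

/-- The increment of u² factors as a sum times a difference, and the difference is a time quotient.
The strip contributes nothing because u = 0 at the interface. -/
theorem hasDerivWithinAt_integral_u_sq (h : MovingHeat α β τ s u ux uxx)
    (hmono : MonotoneOn s (Icc 0 τ)) {t : ℝ} (ht : t ∈ Ioo 0 τ) :
    HasDerivWithinAt (fun r => ∫ x in (0 : ℝ)..(s r), u x r ^ 2)
      (-2 * α * ((∫ x in (0 : ℝ)..(s t), ux x t ^ 2) + u 0 t * ux 0 t)) (Ici t) t := by
  have ht' := Ioo_subset_Ioc_self ht
  have hsub : Icc t τ ⊆ Icc 0 τ := Icc_subset_Icc_left ht.1.le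
  have hs0 := (h.s_pos t (Ioo_subset_Icc_self ht)).le
  have := hasDerivWithinAt_integral_expanding (G := fun x r => u x r ^ 2)
    (Ψ := fun r => ∫ x in (0 : ℝ)..(s t), (u x r + u x t) * timeQuotient α uxx t x r) ht.2
    (hmono.mono hsub) (h.stefan t ht') (h.continuous_s.mono hsub) hs0
    ((h.continuous_u.mono fun p hp => ⟨hsub hp.1, hp.2⟩).pow 2)
    (continuousOn_parametric_integral
      (G := fun x r => (u x r + u x t) * timeQuotient α uxx t x r) hs0 ht.2.le
      (((continuousOn_box hmono ht' h.continuous_u').add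
        (continuousOn_box_const ht' h.continuous_u')).mul (h.continuousOn_timeQuotient hmono ht')))
    (fun r hr => by
      rw [← intervalIntegral.integral_const_mul]
      refine intervalIntegral.integral_congr fun x hx => ?_
      rw [uIcc_of_le hs0] at hx
      have := h.sub_eq_timeQuotient hmono ht' hr hx
      linear_combination (u x r + u x t) * this)
  convert! this using 1
  simp only [timeQuotient_self]
  have e : (fun x => (u x t + u x t) * (α * uxx x t)) = fun x => (2 * α) * (u x t * uxx x t) := by
    funext x; ring
  rw [e, intervalIntegral.integral_const_mul, h.integral_u_mul_uxx ht',
    h.interface t (Ioo_subset_Icc_self ht)]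
  ring

/-- The heat equation at the interface, where the temperature is constant along the interface. -/
theorem alpha_mul_uxx_interface (h : MovingHeat α β τ s u ux uxx)
    (hmono : MonotoneOn s (Icc 0 τ)) {t : ℝ} (ht : t ∈ Ioo 0 τ) :
    α * uxx (s t) t = β * ux (s t) t ^ 2 := by
  have ht' := Ioo_subset_Ioc_self ht
  have hsub : Icc t τ ⊆ Icc 0 τ := Icc_subset_Icc_left ht.1.le
  have hs0 := (h.s_pos t (Ioo_subset_Icc_self ht)).le
  have hst : s t ∈ Icc 0 (s t) := right_mem_Icc.2 hs0
  -- The function r ↦ u(s(t), r) - u(s(t), t) is differentiated twice: through the time quotient,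
  -- and as minus the integral of u_x over the strip from s(t) to s(r), because u vanishes on the
  -- interface.
  have h1 := hasDerivWithinAt_sub_mul (Ψ := fun r => timeQuotient α uxx t (s t) r) ht.2
    ((h.continuousOn_timeQuotient hmono ht').comp (continuousOn_const.prodMk continuousOn_id)
      fun r hr => ⟨hst, hr⟩)
  have h2 := (hasDerivWithinAt_integral_strip (G := ux) ht.2 (hmono.mono hsub) (h.stefan t ht')
    (h.continuous_s.mono hsub) hs0
    (h.continuous_ux.mono fun p hp => ⟨⟨ht.1.trans_le hp.1.1, hp.1.2⟩, hp.2⟩)).neg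
  have h3 : HasDerivWithinAt (fun r => (r - t) * timeQuotient α uxx t (s t) r)
      (-(-β * ux (s t) t * ux (s t) t)) (Ici t) t := by
    refine h2.congr_of_eventuallyEq ?_ (by simp)
    rw [(nhdsWithin_Icc_eq_nhdsGE ht.2).symm]
    filter_upwards [self_mem_nhdsWithin] with r hr
    have hr' : r ∈ Ioc 0 τ := ⟨ht.1.trans_le hr.1, hr.2⟩
    rw [← h.sub_eq_timeQuotient hmono ht' hr hst, Pi.neg_apply,
      h.integral_ux hr' hs0 (hmono (Ioo_subset_Icc_self ht) (hsub hr) hr.1) le_rfl,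
      h.interface r (hsub hr), h.interface t (Ioo_subset_Icc_self ht)]
    ring
  have h4 := (uniqueDiffWithinAt_Ici t).eq_deriv _ h1 h3
  rw [timeQuotient_self] at h4
  rw [h4]
  ring

/-- Integration by parts in x of (u_x(r) + u_x(t)) times the x-derivative of u(r) - u(t). After
division by r - t only time quotients of u occur, so u_xt is never needed. -/
theorem integral_ux_sq_sub (h : MovingHeat α β τ s u ux uxx)
    (hmono : MonotoneOn s (Icc 0 τ)) {t r : ℝ} (ht : t ∈ Ioc 0 τ) (hr : r ∈ Icc t τ) :
    ∫ x in (0 : ℝ)..(s t), (ux x r ^ 2 - ux x t ^ 2)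
      = (ux (s t) r + ux (s t) t) * (u (s t) r - u (s t) t)
        - (ux 0 r + ux 0 t) * (u 0 r - u 0 t)
        - ∫ x in (0 : ℝ)..(s t), (uxx x r + uxx x t) * (u x r - u x t) := by
  have hs0 := (h.s_pos t (Ioc_subset_Icc_self ht)).le
  have hr' : r ∈ Ioc 0 τ := ⟨ht.1.trans_le hr.1, hr.2⟩
  have hst : s t ≤ s r := hmono (Ioc_subset_Icc_self ht) (Ioc_subset_Icc_self hr') hr.1
  have hsub : Icc 0 (s t) ⊆ Icc 0 (s r) := Icc_subset_Icc_right hst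
  have c0 := (((continuousOn_slice h.continuous_u' hr').mono hsub).sub
    (continuousOn_slice h.continuous_u' ht))
  have c1r := (continuousOn_slice h.continuous_ux hr').mono hsub
  have c1t := continuousOn_slice h.continuous_ux ht
  have c2 := (((continuousOn_slice h.continuous_uxx hr').mono hsub).add
    (continuousOn_slice h.continuous_uxx ht))
  have i1 : IntervalIntegrable (fun x => ux x r ^ 2 - ux x t ^ 2) volume 0 (s t) :=
    ContinuousOn.intervalIntegrable (by rw [uIcc_of_le hs0]; exact (c1r.pow 2).sub (c1t.pow 2))
  have i2 : IntervalIntegrable (fun x => (uxx x r + uxx x t) * (u x r - u x t)) volume 0 (s t) :=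
    ContinuousOn.intervalIntegrable (by rw [uIcc_of_le hs0]; exact c2.mul c0)
  have key : ∫ x in (0 : ℝ)..(s t),
      ((ux x r ^ 2 - ux x t ^ 2) + (uxx x r + uxx x t) * (u x r - u x t))
      = (ux (s t) r + ux (s t) t) * (u (s t) r - u (s t) t)
        - (ux 0 r + ux 0 t) * (u 0 r - u 0 t) := by
    refine intervalIntegral.integral_eq_sub_of_hasDerivAt_of_le
      (f := fun x => (ux x r + ux x t) * (u x r - u x t)) hs0
      ((c1r.add c1t).mul c0) (fun x hx => ?_) (i1.add i2)
    have hN := Icc_mem_nhds hx.1 hx.2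
    have hNr := Icc_mem_nhds hx.1 (hx.2.trans_le hst)
    have hxt := Ioo_subset_Icc_self hx
    convert! (((h.deriv_ux r hr' x (hsub hxt)).hasDerivAt hNr).add
      ((h.deriv_ux t ht x hxt).hasDerivAt hN)).mul
      (((h.deriv_u r hr' x (hsub hxt)).hasDerivAt hNr).sub
      ((h.deriv_u t ht x hxt).hasDerivAt hN)) using 1
    simp only [Pi.add_apply, Pi.sub_apply]
    ring
  rw [intervalIntegral.integral_add i1 i2] at key
  linarith

/-- At the interface, 2α u_x u_xx equals 2β u_x³ by `alpha_mul_uxx_interface`, while the moving end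
contributes -β u_x³; the sum is the cubic term. -/
theorem hasDerivWithinAt_integral_ux_sq (h : MovingHeat α β τ s u ux uxx)
    (hmono : MonotoneOn s (Icc 0 τ)) {t : ℝ} (ht : t ∈ Ioo 0 τ) :
    HasDerivWithinAt (fun r => ∫ x in (0 : ℝ)..(s r), ux x r ^ 2)
      (β * ux (s t) t ^ 3 - 2 * α * uxx 0 t * ux 0 t
        - 2 * α * ∫ x in (0 : ℝ)..(s t), uxx x t ^ 2) (Ici t) t := by
  have ht' := Ioo_subset_Ioc_self ht
  have hsub : Icc t τ ⊆ Icc 0 τ := Icc_subset_Icc_left ht.1.le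
  have hs0 := (h.s_pos t (Ioo_subset_Icc_self ht)).le
  have hst : s t ∈ Icc 0 (s t) := right_mem_Icc.2 hs0
  have h0t : (0 : ℝ) ∈ Icc 0 (s t) := left_mem_Icc.2 hs0
  have cΔ := h.continuousOn_timeQuotient hmono ht'
  have cline : ∀ {G : ℝ → ℝ → ℝ}, ContinuousOn (fun p : ℝ × ℝ => G p.1 p.2)
      (Icc 0 (s t) ×ˢ Icc t τ) → ∀ x ∈ Icc 0 (s t), ContinuousOn (fun r => G x r) (Icc t τ) :=
    fun hG x hx => hG.comp (continuousOn_const.prodMk continuousOn_id) fun r hr => ⟨hx, hr⟩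
  have cux := continuousOn_box hmono ht' h.continuous_ux
  have := hasDerivWithinAt_integral_expanding (G := fun x r => ux x r ^ 2)
    (Ψ := fun r => (ux (s t) r + ux (s t) t) * timeQuotient α uxx t (s t) r
      - (ux 0 r + ux 0 t) * timeQuotient α uxx t 0 r
      - ∫ x in (0 : ℝ)..(s t), (uxx x r + uxx x t) * timeQuotient α uxx t x r) ht.2
    (hmono.mono hsub) (h.stefan t ht') (h.continuous_s.mono hsub) hs0
    ((h.continuous_ux.mono fun p hp => ⟨⟨ht.1.trans_le hp.1.1, hp.1.2⟩, hp.2⟩).pow 2)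
    (((((cline cux _ hst).add continuousOn_const).mul (cline cΔ _ hst)).sub
      (((cline cux _ h0t).add continuousOn_const).mul (cline cΔ _ h0t))).sub
      (continuousOn_parametric_integral
        (G := fun x r => (uxx x r + uxx x t) * timeQuotient α uxx t x r) hs0 ht.2.le
        (((continuousOn_box hmono ht' h.continuous_uxx).add
          (continuousOn_box_const ht' h.continuous_uxx)).mul cΔ)))
    (fun r hr => by
      rw [h.integral_ux_sq_sub hmono ht' hr, h.sub_eq_timeQuotient hmono ht' hr hst,
        h.sub_eq_timeQuotient hmono ht' hr h0t]
      have : ∫ x in (0 : ℝ)..(s t), (uxx x r + uxx x t) * (u x r - u x t)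
          = (r - t) * ∫ x in (0 : ℝ)..(s t), (uxx x r + uxx x t) * timeQuotient α uxx t x r := by
        rw [← intervalIntegral.integral_const_mul]
        refine intervalIntegral.integral_congr fun x hx => ?_
        rw [uIcc_of_le hs0] at hx
        have := h.sub_eq_timeQuotient hmono ht' hr hx
        linear_combination (uxx x r + uxx x t) * this
      rw [this]
      ring)
  convert! this using 1
  simp only [timeQuotient_self]
  have e : (fun x => (uxx x t + uxx x t) * (α * uxx x t)) = fun x => (2 * α) * uxx x t ^ 2 := by
    funext x; ring
  rw [e, intervalIntegral.integral_const_mul, h.alpha_mul_uxx_interface hmono ht]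
  ring

end MovingHeat

/-! ### The closed loop -/

/-- The moving heat equation driven by a delayed flux under the delay-compensated feedback law,
up to a finite time `τ`, with nonnegative initial data and positive initial control. -/
structure ClosedLoop (α β k D c sr τ : ℝ) (q s : ℝ → ℝ) (u ux uxx : ℝ → ℝ → ℝ) : Prop where
  k_pos : 0 < k
  D_pos : 0 < D
  c_pos : 0 < c
  sol : MovingHeat α β τ s u ux uxx
  integrable_past : IntegrableOn q (Ioo (-D) 0)
  continuous_input : ContinuousOn q (Ioc (-D) τ)
  flux : ∀ t ∈ Ioc 0 τ, -k * ux 0 t = q (t - D)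
  law : ∀ t ∈ Icc 0 τ, q t = -c * ((∫ θ in (t - D)..t, q θ)
    + k / α * (∫ x in (0 : ℝ)..(s t), u x t) + k / β * (s t - sr))
  initial_nonneg : ∀ x ∈ Icc 0 (s 0), 0 ≤ u x 0
  past_nonneg : ∀ t ∈ Ioo (-D) 0, 0 ≤ q t
  initial_input_pos : 0 < q 0

namespace ClosedLoop

variable {α β k D c sr τ : ℝ} {q s : ℝ → ℝ} {u ux uxx : ℝ → ℝ → ℝ}

theorem restrict (h : ClosedLoop α β k D c sr τ q s u ux uxx) {τ' : ℝ} (hτ : τ' ≤ τ) :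
    ClosedLoop α β k D c sr τ' q s u ux uxx :=
  { h with
    sol := h.sol.restrict hτ
    continuous_input := h.continuous_input.mono (Ioc_subset_Ioc_right hτ)
    flux := fun t ht => h.flux t (Ioc_subset_Ioc_right hτ ht)
    law := fun t ht => h.law t (Icc_subset_Icc_right hτ ht) }

theorem intervalIntegrable_input (h : ClosedLoop α β k D c sr τ q s u ux uxx) {a b : ℝ}
    (ha : a ∈ Icc (-D) τ) (hb : b ∈ Icc (-D) τ) : IntervalIntegrable q volume a b := by
  have h1 : IntegrableOn q (Ioc (-D) τ) := by
    have h2 : IntegrableOn q (Icc 0 τ) :=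
      (h.continuous_input.mono fun t ht =>
        ⟨by linarith [h.D_pos, ht.1], ht.2⟩).integrableOn_compact isCompact_Icc
    refine (h.integrable_past.union h2).mono_set fun t ht => ?_
    rcases lt_or_ge t 0 with h0 | h0
    · exact .inl ⟨ht.1, h0⟩
    · exact .inr ⟨h0, ht.2⟩
  rw [intervalIntegrable_iff]
  exact h1.mono_set fun t ht => ⟨(le_min ha.1 hb.1).trans_lt ht.1, ht.2.trans (max_le ha.2 hb.2)⟩

theorem continuousOn_history (h : ClosedLoop α β k D c sr τ q s u ux uxx) (hτ : 0 ≤ τ) :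
    ContinuousOn (fun t => ∫ θ in (t - D)..t, q θ) (Icc 0 τ) := by
  have hD := h.D_pos
  have hle : -D ≤ τ := by linarith
  have h0 : (0 : ℝ) ∈ Icc (-D) τ := ⟨by linarith, hτ⟩
  have hc : ContinuousOn (fun t => ∫ θ in (0 : ℝ)..t, q θ) (Icc (-D) τ) := by
    have := intervalIntegral.continuousOn_primitive_interval'
      (h.intervalIntegrable_input (left_mem_Icc.2 hle) (right_mem_Icc.2 hle))
      (by rw [uIcc_of_le hle]; exact h0)
    rwa [uIcc_of_le hle] at this
  have m1 : ∀ t ∈ Icc 0 τ, t ∈ Icc (-D) τ := fun t ht => ⟨by linarith [ht.1], ht.2⟩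
  have m2 : ∀ t ∈ Icc 0 τ, t - D ∈ Icc (-D) τ := fun t ht =>
    ⟨by linarith [ht.1], by linarith [ht.2]⟩
  refine ((hc.mono m1).sub (hc.comp (continuousOn_id.sub continuousOn_const) m2)).congr
    fun t ht => ?_
  exact (intervalIntegral.integral_interval_sub_left (h.intervalIntegrable_input h0 (m1 t ht))
    (h.intervalIntegrable_input h0 (m2 t ht))).symm

theorem hasDerivAt_history (h : ClosedLoop α β k D c sr τ q s u ux uxx) {t : ℝ}
    (ht : t ∈ Ioo 0 τ) :
    HasDerivAt (fun t => ∫ θ in (t - D)..t, q θ) (q t - q (t - D)) t := by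
  have hD := h.D_pos
  have h0 : (0 : ℝ) ∈ Icc (-D) τ := ⟨by linarith, (ht.1.trans ht.2).le⟩
  have hc : ContinuousOn q (Ioo (-D) τ) := h.continuous_input.mono Ioo_subset_Ioc_self
  have hd : ∀ r ∈ Ioo (-D) τ, HasDerivAt (fun t => ∫ θ in (0 : ℝ)..t, q θ) (q r) r := fun r hr =>
    intervalIntegral.integral_hasDerivAt_right
      (h.intervalIntegrable_input h0 (Ioo_subset_Icc_self hr))
      (hc.stronglyMeasurableAtFilter isOpen_Ioo r hr) (hc.continuousAt (isOpen_Ioo.mem_nhds hr))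
  have h1 := hd t ⟨by linarith [ht.1], ht.2⟩
  have h2 : HasDerivAt (fun t => ∫ θ in (0 : ℝ)..(t - D), q θ) (q (t - D)) t :=
    (hd (t - D) ⟨by linarith [ht.1], by linarith [ht.2]⟩).comp_sub_const t D
  refine (h1.sub h2).congr_of_eventuallyEq ?_
  filter_upwards [Ioo_mem_nhds ht.1 ht.2] with r hr
  exact (intervalIntegral.integral_interval_sub_left
    (h.intervalIntegrable_input h0 ⟨by linarith [hr.1], hr.2.le⟩)
    (h.intervalIntegrable_input h0 ⟨by linarith [hr.1], by linarith [hr.2]⟩)).symm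

theorem nonneg_of_input_nonneg (h : ClosedLoop α β k D c sr τ q s u ux uxx)
    (hq : ∀ t ∈ Ioc 0 τ, 0 ≤ q (t - D)) : ∀ t ∈ Icc 0 τ, ∀ x ∈ Icc 0 (s t), 0 ≤ u x t :=
  h.sol.nonneg h.initial_nonneg fun t ht => by
    have h1 := h.flux t ht
    have h2 := hq t ht
    have h3 := h.k_pos
    by_contra! h4
    nlinarith [mul_pos h3 h4]

/-- Conservation of heat turns the feedback law into exponential decay of the input. -/
theorem input_eq_of_input_nonneg (h : ClosedLoop α β k D c sr τ q s u ux uxx)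
    (hq : ∀ t ∈ Ioc 0 τ, 0 ≤ q (t - D)) :
    ∀ t ∈ Icc 0 τ, q t = q 0 * Real.exp (-c * t) := by
  intro t ht
  have hτ : 0 ≤ τ := ht.1.trans ht.2
  have hmono := h.sol.monotoneOn_s (h.sol.ux_interface_nonpos (h.nonneg_of_input_nonneg hq))
  have hα := h.sol.alpha_pos
  have hβ := h.sol.beta_pos
  have hc := h.c_pos
  -- E is the bracket of the feedback law, so q = -cE. In E' the delayed input cancels against the
  -- flux at x = 0 and the heat flux at the interface against the melting rate; only q remains.
  set E : ℝ → ℝ := fun t => (∫ θ in (t - D)..t, q θ)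
    + k / α * (∫ x in (0 : ℝ)..(s t), u x t) + k / β * (s t - sr) with hE
  have hEc : ContinuousOn E (Icc 0 τ) :=
    ((h.continuousOn_history hτ).add (continuousOn_const.mul
      (continuousOn_integral_moving hτ h.sol.continuous_s (fun t ht => (h.sol.s_pos t ht).le)
        h.sol.continuous_u))).add
      (continuousOn_const.mul (h.sol.continuous_s.sub continuousOn_const))
  have hEd : ∀ r ∈ Ioo 0 τ, HasDerivWithinAt E (-c * E r) (Ioi r) r := by
    intro r hr
    have d1 := (h.hasDerivAt_history hr).hasDerivWithinAt (s := Ici r)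
    have d2 := (h.sol.hasDerivWithinAt_integral_u hmono hr).const_mul (k / α)
    have d3 := (((h.sol.stefan r (Ioo_subset_Ioc_self hr)).sub_const sr).const_mul
      (k / β)).hasDerivWithinAt (s := Ici r)
    convert! ((d1.add d2).add d3).mono Ioi_subset_Ici_self using 1
    rw [← h.law r (Ioo_subset_Icc_self hr), ← h.flux r (Ioo_subset_Ioc_self hr)]
    field_simp
    ring
  have hsub : Icc 0 t ⊆ Icc 0 τ := Icc_subset_Icc_right ht.2
  -- The function exp(cr) E(r) has right derivative zero, hence is constant.
  have key := intervalIntegral.integral_eq_sub_of_hasDeriv_right_of_le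
    (f := fun r => Real.exp (c * r) * E r) (f' := fun _ => 0) ht.1
    ((Continuous.continuousOn (by fun_prop)).mul (hEc.mono hsub)) (fun r hr => by
      have d1 : HasDerivAt (fun r => Real.exp (c * r)) (Real.exp (c * r) * (c * 1)) r :=
        ((hasDerivAt_id r).const_mul c).exp
      convert! d1.hasDerivWithinAt.mul (hEd r ⟨hr.1, hr.2.trans_le ht.2⟩) using 1
      ring) (by simp)
  simp only [intervalIntegral.integral_zero, mul_zero, Real.exp_zero, one_mul] at key
  have e1 : q t = -c * E t := h.law t ht
  have e2 : q 0 = -c * E 0 := h.law 0 ⟨le_rfl, hτ⟩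
  have e3 : Real.exp (-c * t) * Real.exp (c * t) = 1 := by
    rw [← Real.exp_add]; simp
  rw [e1, e2]
  linear_combination c * E t * e3 + c * Real.exp (-c * t) * key

/-- Method of steps: the sign of q up to time nD fixes the sign of the boundary flux up to (n+1)D,
hence the explicit formula for q, and with it the sign of q, up to (n+1)D. -/
theorem delayed_input_nonneg (h : ClosedLoop α β k D c sr τ q s u ux uxx) :
    ∀ t ∈ Ioc 0 τ, 0 ≤ q (t - D) := by
  have hD := h.D_pos
  have key : ∀ n : ℕ, ∀ t ∈ Icc 0 τ, t ≤ n * D → 0 ≤ q t := by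
    intro n
    induction n with
    | zero =>
      intro t ht htn
      have : t = 0 := le_antisymm (by simpa using htn) ht.1
      rw [this]
      exact h.initial_input_pos.le
    | succ n ih =>
      intro t ht htn
      push_cast at htn
      -- Truncation at t matters: the formula on [0, t] needs the sign of q only up to t - D ≤ nD.
      rw [(h.restrict ht.2).input_eq_of_input_nonneg (fun r hr => ?_) t ⟨ht.1, le_rfl⟩]
      · exact mul_nonneg h.initial_input_pos.le (Real.exp_pos _).le
      · rcases lt_or_ge (r - D) 0 with h0 | h0
        · exact h.past_nonneg _ ⟨by linarith [hr.1], h0⟩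
        · exact ih _ ⟨h0, by linarith [hr.2, ht.2]⟩ (by linarith [hr.2])
  intro t ht
  rcases lt_or_ge (t - D) 0 with h0 | h0
  · exact h.past_nonneg _ ⟨by linarith [ht.1], h0⟩
  · obtain ⟨n, hn⟩ := exists_nat_ge ((t - D) / D)
    exact key n _ ⟨h0, by linarith [ht.2]⟩ ((div_le_iff₀ hD).1 hn)

theorem temp_nonneg (h : ClosedLoop α β k D c sr τ q s u ux uxx) :
    ∀ t ∈ Icc 0 τ, ∀ x ∈ Icc 0 (s t), 0 ≤ u x t :=
  h.nonneg_of_input_nonneg h.delayed_input_nonneg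

theorem input_eq (h : ClosedLoop α β k D c sr τ q s u ux uxx) :
    ∀ t ∈ Icc 0 τ, q t = q 0 * Real.exp (-c * t) :=
  h.input_eq_of_input_nonneg h.delayed_input_nonneg

theorem ux_interface_nonpos (h : ClosedLoop α β k D c sr τ q s u ux uxx) :
    ∀ t ∈ Ioc 0 τ, ux (s t) t ≤ 0 :=
  h.sol.ux_interface_nonpos h.temp_nonneg

theorem monotoneOn_s (h : ClosedLoop α β k D c sr τ q s u ux uxx) : MonotoneOn s (Icc 0 τ) :=
  h.sol.monotoneOn_s h.ux_interface_nonpos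

/-- If s exceeded s_r, every term of the bracket would be nonnegative and the last one positive, so
q would be negative. -/
theorem s_le_setpoint (h : ClosedLoop α β k D c sr τ q s u ux uxx) :
    ∀ t ∈ Icc 0 τ, s t ≤ sr := by
  intro t ht
  have hD := h.D_pos
  have hc := h.c_pos
  have hqn : ∀ r ∈ Icc 0 τ, 0 ≤ q r := fun r hr => by
    rw [h.input_eq r hr]
    exact mul_nonneg h.initial_input_pos.le (Real.exp_pos _).le
  have h1 : 0 ≤ ∫ θ in (t - D)..t, q θ := by
    rw [intervalIntegral.integral_of_le (by linarith)]
    refine setIntegral_nonneg measurableSet_Ioc fun θ hθ => ?_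
    rcases lt_or_ge θ 0 with h0 | h0
    · exact h.past_nonneg _ ⟨by linarith [ht.1, hθ.1], h0⟩
    · exact hqn θ ⟨h0, hθ.2.trans ht.2⟩
  have h2 : 0 ≤ ∫ x in (0 : ℝ)..(s t), u x t :=
    intervalIntegral.integral_nonneg (h.sol.s_pos t ht).le fun x hx => h.temp_nonneg t ht x hx
  have h3 := h.law t ht
  have h4 := hqn t ht
  by_contra! h5
  have h6 : 0 < k / β * (s t - sr) :=
    mul_pos (div_pos h.k_pos h.sol.beta_pos) (sub_pos.2 h5)
  have h7 : 0 ≤ k / α * ∫ x in (0 : ℝ)..(s t), u x t :=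
    mul_nonneg (div_pos h.k_pos h.sol.alpha_pos).le h2
  nlinarith

end ClosedLoop

/-! ### Energies, Poincaré inequalities and the trace at the fixed end -/

namespace MovingHeat

variable {α β τ : ℝ} {s : ℝ → ℝ} {u ux uxx : ℝ → ℝ → ℝ}

/-- The squared `L²` norm of the temperature. -/
def energy (s : ℝ → ℝ) (u : ℝ → ℝ → ℝ) (t : ℝ) : ℝ := ∫ x in (0 : ℝ)..(s t), u x t ^ 2

theorem energy_nonneg (h : MovingHeat α β τ s u ux uxx) (v : ℝ → ℝ → ℝ) {t : ℝ}
    (ht : t ∈ Icc 0 τ) : 0 ≤ energy s v t :=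
  intervalIntegral.integral_nonneg (h.s_pos t ht).le fun _ _ => sq_nonneg _

theorem continuousOn_energy (h : MovingHeat α β τ s u ux uxx) {v : ℝ → ℝ → ℝ}
    (hv : ContinuousOn (fun p : ℝ × ℝ => v p.1 p.2) {p | p.2 ∈ Ioc 0 τ ∧ p.1 ∈ Icc 0 (s p.2)})
    {a b : ℝ} (ha : 0 < a) (hab : a ≤ b) (hb : b ≤ τ) :
    ContinuousOn (energy s v) (Icc a b) := by
  have hsub : Icc a b ⊆ Ioc 0 τ := fun t ht => ⟨ha.trans_le ht.1, ht.2.trans hb⟩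
  exact continuousOn_integral_moving (G := fun x t => v x t ^ 2) hab
    (h.continuous_s.mono (hsub.trans Ioc_subset_Icc_self))
    (fun t ht => (h.s_pos t (Ioc_subset_Icc_self (hsub ht))).le)
    ((hv.mono fun p hp => ⟨hsub hp.1, hp.2⟩).pow 2)

/-- Since u vanishes at the interface, u(x) is minus the integral of u_x over [x, s(t)]; then
Cauchy–Schwarz. -/
theorem u_sq_le (h : MovingHeat α β τ s u ux uxx) {t x : ℝ} (ht : t ∈ Ioc 0 τ)
    (hx : x ∈ Icc 0 (s t)) : u x t ^ 2 ≤ s t * energy s ux t := by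
  have htI := Ioc_subset_Icc_self ht
  have c1 := continuousOn_slice h.continuous_ux ht
  have hs0 := (h.s_pos t htI).le
  have hii : ∀ {w : ℝ → ℝ}, ContinuousOn w (Icc 0 (s t)) → ∀ a ∈ Icc 0 (s t), ∀ b ∈ Icc 0 (s t),
      IntervalIntegrable w volume a b := fun hw a ha b hb =>
    (hw.mono (ordConnected_Icc.uIcc_subset ha hb)).intervalIntegrable
  have hst : s t ∈ Icc 0 (s t) := right_mem_Icc.2 hs0
  have h0t : (0 : ℝ) ∈ Icc 0 (s t) := left_mem_Icc.2 hs0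
  have c2 : ContinuousOn (fun x => ux x t ^ 2) (Icc 0 (s t)) := c1.pow 2
  have h1 := h.integral_ux ht hx.1 hx.2 le_rfl
  rw [h.interface t htI] at h1
  have h2 := sq_integral_le hx.2 (hii c1 x hx _ hst) (hii c2 x hx _ hst)
  have h3 := intervalIntegral.integral_add_adjacent_intervals (hii c2 _ h0t x hx)
    (hii c2 x hx _ hst)
  have h4 : 0 ≤ ∫ y in (0 : ℝ)..x, ux y t ^ 2 :=
    intervalIntegral.integral_nonneg hx.1 fun _ _ => sq_nonneg _
  have h5 : 0 ≤ ∫ y in x..(s t), ux y t ^ 2 :=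
    intervalIntegral.integral_nonneg hx.2 fun _ _ => sq_nonneg _
  rw [h1] at h2
  simp only [energy]
  calc u x t ^ 2 = (0 - u x t) ^ 2 := by ring
    _ ≤ (s t - x) * ∫ y in x..(s t), ux y t ^ 2 := h2
    _ ≤ s t * ∫ y in (0 : ℝ)..(s t), ux y t ^ 2 :=
      mul_le_mul (by linarith [hx.1]) (by linarith) h5 hs0

theorem energy_le (h : MovingHeat α β τ s u ux uxx) {t : ℝ} (ht : t ∈ Ioc 0 τ) :
    energy s u t ≤ s t ^ 2 * energy s ux t := by
  have hs0 := (h.s_pos t (Ioc_subset_Icc_self ht)).le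
  have c0 : ContinuousOn (fun x => u x t ^ 2) (Icc 0 (s t)) :=
    (continuousOn_slice h.continuous_u' ht).pow 2
  calc energy s u t ≤ ∫ _ in (0 : ℝ)..(s t), s t * energy s ux t :=
        intervalIntegral.integral_mono_on hs0
          (ContinuousOn.intervalIntegrable (by rwa [uIcc_of_le hs0])) (by simp)
          fun x hx => h.u_sq_le ht hx
    _ = s t ^ 2 * energy s ux t := by simp; ring

theorem hasDerivWithinAt_u_zero (h : MovingHeat α β τ s u ux uxx)
    (hmono : MonotoneOn s (Icc 0 τ)) {t : ℝ} (ht : t ∈ Ioo 0 τ) :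
    HasDerivWithinAt (fun r => u 0 r) (α * uxx 0 t) (Ici t) t := by
  have ht' := Ioo_subset_Ioc_self ht
  have h0 : (0 : ℝ) ∈ Icc 0 (s t) := left_mem_Icc.2 (h.s_pos t (Ioo_subset_Icc_self ht)).le
  have h1 := (hasDerivWithinAt_sub_mul (Ψ := fun r => timeQuotient α uxx t 0 r) ht.2
    ((h.continuousOn_timeQuotient hmono ht').comp (continuousOn_const.prodMk continuousOn_id)
      fun r hr => ⟨h0, hr⟩)).const_add (u 0 t)
  rw [timeQuotient_self] at h1
  refine h1.congr_of_eventuallyEq ?_ (by simp)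
  rw [(nhdsWithin_Icc_eq_nhdsGE ht.2).symm]
  filter_upwards [self_mem_nhdsWithin] with r hr
  linarith [h.sub_eq_timeQuotient hmono ht' hr h0]

theorem continuousOn_at_zero (h : MovingHeat α β τ s u ux uxx) {G : ℝ → ℝ → ℝ}
    (hG : ContinuousOn (fun p : ℝ × ℝ => G p.1 p.2) {p | p.2 ∈ Ioc 0 τ ∧ p.1 ∈ Icc 0 (s p.2)}) :
    ContinuousOn (fun t => G 0 t) (Ioc 0 τ) :=
  hG.comp (continuousOn_const.prodMk continuousOn_id) fun t ht =>
    ⟨ht, le_rfl, (h.s_pos t (Ioc_subset_Icc_self ht)).le⟩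

end MovingHeat

/-! ### The weighted energy estimate and decay of the temperature -/

namespace ClosedLoop

open MovingHeat

variable {α β k D c sr τ : ℝ} {q s : ℝ → ℝ} {u ux uxx : ℝ → ℝ → ℝ}

/-- The factor α u_xx(0,t) is kept apart: it is the right time derivative of u(0,t), to be
integrated by parts against the delayed input. -/
theorem hasDerivWithinAt_energy_add (h : ClosedLoop α β k D c sr τ q s u ux uxx) {t : ℝ}
    (ht : t ∈ Ioo 0 τ) :
    HasDerivWithinAt (fun r => energy s u r + energy s ux r)
      (-2 * α * energy s ux t + 2 * α / k * (u 0 t * q (t - D))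
        + 2 / k * q (t - D) * (α * uxx 0 t) + β * ux (s t) t ^ 3
        - 2 * α * energy s uxx t) (Ici t) t := by
  have hk := h.k_pos
  have hflux := h.flux t (Ioo_subset_Ioc_self ht)
  have e : ux 0 t = -(q (t - D) / k) := by
    rw [← hflux]
    field_simp
  convert! (h.sol.hasDerivWithinAt_integral_u_sq h.monotoneOn_s ht).add
    (h.sol.hasDerivWithinAt_integral_ux_sq h.monotoneOn_s ht) using 1
  rw [e]
  simp only [energy]
  ring

/-- Here L and F stand for the squared norms of u and u_x, y for u(0,t), p for the delayed input and
g for its derivative. Half of the dissipation 2αF pays for the weight b(L + F); the other half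
absorbs y through Young's inequality. -/
theorem dissipation_le {α b S F L y p g k : ℝ} (hα : 0 < α) (hk : 0 < k) (hS : 0 < S)
    (hb0 : 0 ≤ b) (hb : b * (S ^ 2 + 1) ≤ α) (hy : y ^ 2 ≤ S * F) (hL : L ≤ S ^ 2 * F) :
    b * (L + F) - 2 * α * F + 2 * α / k * (y * p) - 2 / k * (b * p * y) - 2 / k * (g * y)
      ≤ 2 * S * (α ^ 2 + 1) / (α * k ^ 2) * (p ^ 2 + g ^ 2) := by
  set X := 2 / k * ((α - b) * p - g) with hX
  have h1 : b * (L + F) ≤ α * F := by nlinarith [mul_le_mul_of_nonneg_left hL hb0]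
  have h2 : y * X ≤ α / S * y ^ 2 + S / (4 * α) * X ^ 2 := by
    have : 0 ≤ (2 * α * y - S * X) ^ 2 / (4 * α * S) := by positivity
    have e : (2 * α * y - S * X) ^ 2 / (4 * α * S)
        = α / S * y ^ 2 + S / (4 * α) * X ^ 2 - y * X := by field_simp; ring
    linarith
  have h3 : α / S * y ^ 2 ≤ α * F := by
    calc α / S * y ^ 2 ≤ α / S * (S * F) := by gcongr
      _ = α * F := by field_simp
  have hbα : b ≤ α := by nlinarith [sq_nonneg S]
  have h4 : ((α - b) * p - g) ^ 2 ≤ 2 * (α ^ 2 + 1) * (p ^ 2 + g ^ 2) := by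
    have : (α - b) ^ 2 ≤ α ^ 2 := by
      apply pow_le_pow_left₀ <;> linarith
    nlinarith [sq_nonneg ((α - b) * p + g), mul_le_mul_of_nonneg_right this (sq_nonneg p),
      mul_nonneg (sq_nonneg α) (sq_nonneg g), sq_nonneg p]
  have h5 : S / (4 * α) * X ^ 2 ≤ 2 * S * (α ^ 2 + 1) / (α * k ^ 2) * (p ^ 2 + g ^ 2) := by
    have e : S / (4 * α) * X ^ 2 = S / (α * k ^ 2) * ((α - b) * p - g) ^ 2 := by
      rw [hX]; field_simp; ring
    rw [e]
    calc _ ≤ S / (α * k ^ 2) * (2 * (α ^ 2 + 1) * (p ^ 2 + g ^ 2)) := by gcongr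
      _ = _ := by ring
  have e : 2 * α / k * (y * p) - 2 / k * (b * p * y) - 2 / k * (g * y) = y * X := by
    rw [hX]; ring
  linarith

/-- Integrates the derivative of exp(bt) times the energy over [t₁, t₂]. The time derivative of
u(0,t) is moved onto the input, which leaves the two end terms and an integrand controlled by
`dissipation_le`. Since u_x is not continuous down to time 0, t₁ is positive. -/
theorem energy_estimate (h : ClosedLoop α β k D c sr τ q s u ux uxx) {g : ℝ → ℝ} {b S : ℝ}
    (hS : 0 < S) (hsS : sr ≤ S) (hb0 : 0 ≤ b) (hb : b * (S ^ 2 + 1) ≤ α)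
    (hg : IntervalIntegrable g volume (-D) τ)
    (hg2 : IntervalIntegrable (fun θ => g θ ^ 2) volume (-D) τ)
    (hqg : ∀ x ∈ Ioc (-D) τ, ∀ y ∈ Ioc (-D) τ, x ≤ y → q y - q x = ∫ θ in x..y, g θ)
    {t₁ t₂ : ℝ} (h1 : 0 < t₁) (h12 : t₁ ≤ t₂) (h2 : t₂ ≤ τ) :
    Real.exp (b * t₂) * (energy s u t₂ + energy s ux t₂)
      ≤ Real.exp (b * t₁) * (energy s u t₁ + energy s ux t₁)
        + 2 / k * (q (t₂ - D) * (Real.exp (b * t₂) * u 0 t₂)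
          - q (t₁ - D) * (Real.exp (b * t₁) * u 0 t₁))
        + 2 * S * (α ^ 2 + 1) / (α * k ^ 2)
          * ∫ t in t₁..t₂, Real.exp (b * t) * (q (t - D) ^ 2 + g (t - D) ^ 2) := by
  have hα := h.sol.alpha_pos
  have hβ := h.sol.beta_pos
  have hk := h.k_pos
  have hD := h.D_pos
  have hsubc : Icc t₁ t₂ ⊆ Ioc 0 τ := fun t ht => ⟨h1.trans_le ht.1, ht.2.trans h2⟩
  have hsubo : Ioo t₁ t₂ ⊆ Ioo 0 τ := fun t ht => ⟨h1.trans ht.1, ht.2.trans_le h2⟩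
  have hexp : ContinuousOn (fun t => Real.exp (b * t)) (Icc t₁ t₂) :=
    Continuous.continuousOn (by fun_prop)
  have hexpd : ∀ t, HasDerivAt (fun t => Real.exp (b * t)) (Real.exp (b * t) * b) t := fun t => by
    simpa using ((hasDerivAt_id t).const_mul b).exp
  have cL := h.sol.continuousOn_energy h.sol.continuous_u' h1 h12 h2
  have cF := h.sol.continuousOn_energy h.sol.continuous_ux h1 h12 h2
  have cy := (h.sol.continuousOn_at_zero h.sol.continuous_u').mono hsubc
  have cy' : ContinuousOn (fun t => α * uxx 0 t) (Icc t₁ t₂) :=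
    continuousOn_const.mul ((h.sol.continuousOn_at_zero h.sol.continuous_uxx).mono hsubc)
  have cp : ContinuousOn (fun t => q (t - D)) (Icc t₁ t₂) :=
    h.continuous_input.comp (continuousOn_id.sub continuousOn_const) fun t ht =>
      ⟨by linarith [ht.1], by linarith [ht.2]⟩
  set H : ℝ → ℝ := fun t => Real.exp (b * t) * u 0 t with hH
  set H' : ℝ → ℝ := fun t => Real.exp (b * t) * b * u 0 t + Real.exp (b * t) * (α * uxx 0 t)
    with hH'
  have cH : ContinuousOn H (Icc t₁ t₂) := hexp.mul cy
  have cH' : ContinuousOn H' (Icc t₁ t₂) :=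
    ((hexp.mul continuousOn_const).mul cy).add (hexp.mul cy')
  have ii : ∀ {w : ℝ → ℝ}, ContinuousOn w (Icc t₁ t₂) → IntervalIntegrable w volume t₁ t₂ :=
    fun hw => ContinuousOn.intervalIntegrable (by rwa [uIcc_of_le h12])
  have shift : ∀ {w : ℝ → ℝ}, IntervalIntegrable w volume (-D) τ →
      IntervalIntegrable (fun t => w (t - D)) volume t₁ t₂ := fun hw => by
    have : IntervalIntegrable _ volume (t₁ - D) (t₂ - D) := hw.mono_set (by
      rw [uIcc_of_le (by linarith), uIcc_of_le (by linarith)]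
      exact Icc_subset_Icc (by linarith) (by linarith))
    simpa using this.comp_sub_right D
  have ig := shift hg
  have ig2 := shift hg2
  -- The input is only a primitive of g and H has only a right derivative; both are indefinite
  -- integrals, which is enough for integration by parts.
  have hIBP := integral_deriv_mul_add_of_primitive (f := fun t => q (t - D)) (g := H)
    (f' := fun t => g (t - D)) (g' := H') h12 ig (ii cH')
    (fun x hx => by
      rw [intervalIntegral.integral_comp_sub_right (fun θ => g θ) D,
        ← hqg (t₁ - D) ⟨by linarith, by linarith⟩ (x - D)
          ⟨by linarith [hx.1], by linarith [hx.2]⟩ (by linarith [hx.1])]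
      ring)
    (fun x hx => by
      rw [intervalIntegral.integral_eq_sub_of_hasDeriv_right_of_le (f := H) hx.1
        (cH.mono (Icc_subset_Icc_right hx.2)) (fun t ht => ?_)
        ((ii cH').mono_set (by
          rw [uIcc_of_le hx.1, uIcc_of_le h12]; exact Icc_subset_Icc_right hx.2))]
      · ring
      · exact (hexpd t).hasDerivWithinAt.mul ((h.sol.hasDerivWithinAt_u_zero h.monotoneOn_s
          (hsubo ⟨ht.1, ht.2.trans_le hx.2⟩)).mono Ioi_subset_Ici_self))
  -- φ drops the nonpositive cubic term and the dissipation of u_xx from the derivative of the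
  -- weighted energy.
  set φ : ℝ → ℝ := fun t => Real.exp (b * t) * (b * (energy s u t + energy s ux t)
    - 2 * α * energy s ux t + 2 * α / k * (u 0 t * q (t - D))
    + 2 / k * q (t - D) * (α * uxx 0 t)) with hφ
  have cφ : ContinuousOn φ (Icc t₁ t₂) :=
    hexp.mul ((((continuousOn_const.mul (cL.add cF)).sub (continuousOn_const.mul cF)).add
      (continuousOn_const.mul (cy.mul cp))).add ((continuousOn_const.mul cp).mul cy'))
  have hstep1 := intervalIntegral.sub_le_integral_of_hasDeriv_right_of_le (φ := φ)
    (g := fun t => Real.exp (b * t) * (energy s u t + energy s ux t)) h12 (hexp.mul (cL.add cF))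
    (fun t ht => ((hexpd t).hasDerivWithinAt.mul
      ((h.hasDerivWithinAt_energy_add (hsubo ht)).mono Ioi_subset_Ici_self)))
    (cφ.integrableOn_compact isCompact_Icc)
    (fun t ht => by
      have ht' := hsubo ht
      have e1 : β * ux (s t) t ^ 3 ≤ 0 := by
        have := h.ux_interface_nonpos t (Ioo_subset_Ioc_self ht')
        exact mul_nonpos_of_nonneg_of_nonpos hβ.le (Odd.pow_nonpos (by decide) this)
      have e2 : 0 ≤ 2 * α * energy s uxx t :=
        mul_nonneg (by linarith) (h.sol.energy_nonneg uxx (Ioo_subset_Icc_self ht'))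
      have e3 := Real.exp_pos (b * t)
      simp only [hφ]
      nlinarith)
  have iJ : IntervalIntegrable (fun t => Real.exp (b * t) * (q (t - D) ^ 2 + g (t - D) ^ 2))
      volume t₁ t₂ :=
    ((ii (cp.pow 2)).add ig2).continuousOn_mul (by rwa [uIcc_of_le h12])
  have iK : IntervalIntegrable (fun t => g (t - D) * H t + q (t - D) * H' t) volume t₁ t₂ :=
    (ig.mul_continuousOn (by rwa [uIcc_of_le h12])).add (ii (cp.mul cH'))
  have hstep2 : ∫ t in t₁..t₂, φ t
      ≤ ∫ t in t₁..t₂, (2 * S * (α ^ 2 + 1) / (α * k ^ 2)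
          * (Real.exp (b * t) * (q (t - D) ^ 2 + g (t - D) ^ 2))
        + 2 / k * (g (t - D) * H t + q (t - D) * H' t)) := by
    refine intervalIntegral.integral_mono_on h12 (ii cφ)
      ((iJ.const_mul _).add (iK.const_mul _)) fun t ht => ?_
    have ht' := hsubc ht
    have hsS' : s t ≤ S := (h.s_le_setpoint t (Ioc_subset_Icc_self ht')).trans hsS
    have hs0 := (h.sol.s_pos t (Ioc_subset_Icc_self ht')).le
    have hF := h.sol.energy_nonneg ux (Ioc_subset_Icc_self ht')
    have hy : u 0 t ^ 2 ≤ S * energy s ux t :=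
      (h.sol.u_sq_le ht' ⟨le_rfl, hs0⟩).trans (mul_le_mul_of_nonneg_right hsS' hF)
    have hL : energy s u t ≤ S ^ 2 * energy s ux t :=
      (h.sol.energy_le ht').trans (mul_le_mul_of_nonneg_right
        (pow_le_pow_left₀ hs0 hsS' 2) hF)
    have hdis := dissipation_le (p := q (t - D)) (g := g (t - D)) hα hk hS hb0 hb hy hL
    have := mul_le_mul_of_nonneg_left hdis (Real.exp_pos (b * t)).le
    simp only [hφ, hH, hH']
    linarith
  rw [intervalIntegral.integral_add (iJ.const_mul _) (iK.const_mul _),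
    intervalIntegral.integral_const_mul, intervalIntegral.integral_const_mul, hIBP] at hstep2
  simp only [hH] at hstep2 ⊢
  linarith

/-- Decay of the temperature, given bounds on the delayed input. -/
theorem energy_decay (h : ClosedLoop α β k D c sr τ q s u ux uxx) {g : ℝ → ℝ} {b S B : ℝ}
    (hS : 0 < S) (hsS : sr ≤ S) (hb0 : 0 ≤ b) (hb : b * (S ^ 2 + 1) ≤ α)
    (hg : IntervalIntegrable g volume (-D) τ)
    (hg2 : IntervalIntegrable (fun θ => g θ ^ 2) volume (-D) τ)
    (hqg : ∀ x ∈ Ioc (-D) τ, ∀ y ∈ Ioc (-D) τ, x ≤ y → q y - q x = ∫ θ in x..y, g θ)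
    {t₁ t₂ : ℝ} (h1 : 0 < t₁) (h12 : t₁ ≤ t₂) (h2 : t₂ ≤ τ)
    (hB : ∀ t ∈ Ioc 0 τ, Real.exp (b * t) * q (t - D) ^ 2 ≤ B)
    (hBI : ∫ t in t₁..t₂, Real.exp (b * t) * (q (t - D) ^ 2 + g (t - D) ^ 2) ≤ B) :
    Real.exp (b * t₂) * (energy s u t₂ + energy s ux t₂)
      ≤ 3 * (Real.exp (b * t₁) * (energy s u t₁ + energy s ux t₁))
        + (8 * S / k ^ 2 + 4 * S * (α ^ 2 + 1) / (α * k ^ 2)) * B := by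
  have hα := h.sol.alpha_pos
  have hk := h.k_pos
  have hest := h.energy_estimate hS hsS hb0 hb hg hg2 hqg h1 h12 h2
  -- Young's inequality with the weight that leaves half of the energy. At t₂ this half is absorbed
  -- on the left, and at t₁ it raises 1 to 3/2; doubling gives the factors 3 and 8S/k².
  have hend : ∀ t ∈ Ioc 0 τ, |2 / k * (q (t - D) * (Real.exp (b * t) * u 0 t))|
      ≤ 1 / 2 * (Real.exp (b * t) * (energy s u t + energy s ux t)) + 2 * S / k ^ 2 * B := by
    intro t ht
    have htI := Ioc_subset_Icc_self ht
    have hsS' : s t ≤ S := (h.s_le_setpoint t htI).trans hsS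
    have hs0 := (h.sol.s_pos t htI).le
    have hF := h.sol.energy_nonneg ux htI
    have hL := h.sol.energy_nonneg u htI
    have hy : u 0 t ^ 2 ≤ S * energy s ux t :=
      (h.sol.u_sq_le ht ⟨le_rfl, hs0⟩).trans (mul_le_mul_of_nonneg_right hsS' hF)
    have e0 := Real.exp_pos (b * t)
    have e1 : |2 / k * (q (t - D) * u 0 t)|
        ≤ 1 / 2 * energy s ux t + 2 * S / k ^ 2 * q (t - D) ^ 2 := by
      have hy2 : u 0 t ^ 2 / (2 * S) ≤ 1 / 2 * energy s ux t := by
        rw [div_le_iff₀ (by positivity)]; linarith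
      refine le_trans ?_ (add_le_add_left hy2 _)
      rw [abs_le]
      constructor
      · have : 0 ≤ (k * u 0 t + 2 * S * q (t - D)) ^ 2 / (2 * S * k ^ 2) := by positivity
        have e : (k * u 0 t + 2 * S * q (t - D)) ^ 2 / (2 * S * k ^ 2)
          = u 0 t ^ 2 / (2 * S) + 2 * S / k ^ 2 * q (t - D) ^ 2
            + 2 / k * (q (t - D) * u 0 t) := by field_simp; ring
        linarith
      · have : 0 ≤ (k * u 0 t - 2 * S * q (t - D)) ^ 2 / (2 * S * k ^ 2) := by positivity
        have e : (k * u 0 t - 2 * S * q (t - D)) ^ 2 / (2 * S * k ^ 2)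
          = u 0 t ^ 2 / (2 * S) + 2 * S / k ^ 2 * q (t - D) ^ 2
            - 2 / k * (q (t - D) * u 0 t) := by field_simp; ring
        linarith
    have e2 : 2 / k * (q (t - D) * (Real.exp (b * t) * u 0 t))
        = Real.exp (b * t) * (2 / k * (q (t - D) * u 0 t)) := by ring
    rw [e2, abs_mul, abs_of_pos e0]
    calc Real.exp (b * t) * |2 / k * (q (t - D) * u 0 t)|
        ≤ Real.exp (b * t) * (1 / 2 * energy s ux t + 2 * S / k ^ 2 * q (t - D) ^ 2) := by gcongr
      _ = 1 / 2 * (Real.exp (b * t) * energy s ux t)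
          + 2 * S / k ^ 2 * (Real.exp (b * t) * q (t - D) ^ 2) := by ring
      _ ≤ _ := by
        have := hB t ht
        gcongr
        linarith
  have hs1 := (abs_le.1 (hend t₁ ⟨h1, h12.trans h2⟩)).1
  have hs2 := (abs_le.1 (hend t₂ ⟨h1.trans_le h12, h2⟩)).2
  have hI : 2 * S * (α ^ 2 + 1) / (α * k ^ 2)
      * ∫ t in t₁..t₂, Real.exp (b * t) * (q (t - D) ^ 2 + g (t - D) ^ 2)
      ≤ 2 * S * (α ^ 2 + 1) / (α * k ^ 2) * B := by gcongr
  have hc1 : 8 * S / k ^ 2 * B = 4 * (2 * S / k ^ 2 * B) := by ring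
  have hc2 : 4 * S * (α ^ 2 + 1) / (α * k ^ 2) * B
      = 2 * (2 * S * (α ^ 2 + 1) / (α * k ^ 2) * B) := by ring
  rw [add_mul, hc1, hc2]
  linarith

end ClosedLoop

/-! ### Decay of the input and the final constants -/

/-- `g` is a square-integrable derivative of the input `q` on `(-D, τ)`, given by the exponential
decay of the input at positive times. -/
structure InputDeriv (D c τ : ℝ) (q g : ℝ → ℝ) : Prop where
  input_sq : IntervalIntegrable (fun θ => q θ ^ 2) volume (-D) τ
  deriv : IntervalIntegrable g volume (-D) τ
  deriv_sq : IntervalIntegrable (fun θ => g θ ^ 2) volume (-D) τ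
  sub_eq : ∀ x ∈ Ioc (-D) τ, ∀ y ∈ Ioc (-D) τ, x ≤ y → q y - q x = ∫ θ in x..y, g θ
  eq_after : ∀ θ ∈ Icc 0 τ, g θ = -c * q θ

/-- The squared `H¹(a, b)` norm of an input with derivative `g`. -/
def inputEnergy (q g : ℝ → ℝ) (a b : ℝ) : ℝ := ∫ θ in a..b, (q θ ^ 2 + g θ ^ 2)

namespace ClosedLoop

open MovingHeat

variable {α β k D c sr τ : ℝ} {q s g : ℝ → ℝ} {u ux uxx : ℝ → ℝ → ℝ}

theorem inputEnergy_nonneg (q g : ℝ → ℝ) {a b : ℝ} (hab : a ≤ b) : 0 ≤ inputEnergy q g a b :=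
  intervalIntegral.integral_nonneg hab fun _ _ => by positivity

theorem intervalIntegrable_of_subset {w : ℝ → ℝ} (hw : IntervalIntegrable w volume (-D) τ)
    {a b : ℝ} (ha : -D ≤ a) (hab : a ≤ b) (hb : b ≤ τ) : IntervalIntegrable w volume a b :=
  hw.mono_set (by
    rw [uIcc_of_le hab, uIcc_of_le (ha.trans (hab.trans hb))]
    exact Icc_subset_Icc ha hb)

/-- An input in `H¹` is bounded on its past. -/
theorem past_input_sq_le (h : ClosedLoop α β k D c sr τ q s u ux uxx)
    (hd : InputDeriv D c τ q g) {θ : ℝ} (hτ : 0 ≤ τ) (hθ : θ ∈ Ioc (-D) 0) :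
    q θ ^ 2 ≤ (2 + 2 * D) * (inputEnergy q g (-D) 0 + q 0 ^ 2) := by
  have hD := h.D_pos
  have h1 := hd.sub_eq θ ⟨hθ.1, hθ.2.trans hτ⟩ 0 ⟨by linarith, hτ⟩ hθ.2
  have h2 := sq_integral_le hθ.2 (intervalIntegrable_of_subset hd.deriv hθ.1.le hθ.2 hτ)
    (intervalIntegrable_of_subset hd.deriv_sq hθ.1.le hθ.2 hτ)
  rw [← h1] at h2
  have i1 := hd.input_sq.add hd.deriv_sq
  have h3 : ∫ y in θ..0, g y ^ 2 ≤ inputEnergy q g (-D) 0 := by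
    rw [inputEnergy, ← intervalIntegral.integral_add_adjacent_intervals
      (intervalIntegrable_of_subset i1 le_rfl hθ.1.le (hθ.2.trans hτ))
      (intervalIntegrable_of_subset i1 hθ.1.le hθ.2 hτ)]
    have e1 : 0 ≤ ∫ y in (-D)..θ, (q y ^ 2 + g y ^ 2) :=
      intervalIntegral.integral_nonneg hθ.1.le fun _ _ => by positivity
    have e2 : ∫ y in θ..0, g y ^ 2 ≤ ∫ y in θ..0, (q y ^ 2 + g y ^ 2) :=
      intervalIntegral.integral_mono_on hθ.2
        (intervalIntegrable_of_subset hd.deriv_sq hθ.1.le hθ.2 hτ)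
        (intervalIntegrable_of_subset i1 hθ.1.le hθ.2 hτ) fun y _ => by
          nlinarith [sq_nonneg (q y)]
    linarith
  have h4 : 0 ≤ ∫ y in θ..0, g y ^ 2 :=
    intervalIntegral.integral_nonneg hθ.2 fun _ _ => sq_nonneg _
  have h5 : (q 0 - q θ) ^ 2 ≤ D * inputEnergy q g (-D) 0 :=
    h2.trans (mul_le_mul (by linarith [hθ.1]) h3 h4 hD.le)
  nlinarith [sq_nonneg (q 0 + (q 0 - q θ)), mul_nonneg hD.le (sq_nonneg (q 0)),
    inputEnergy_nonneg q g (neg_nonpos.2 hD.le)]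

theorem exp_mul_delayed_input_sq_le (h : ClosedLoop α β k D c sr τ q s u ux uxx)
    (hd : InputDeriv D c τ q g) {b : ℝ} (hb0 : 0 ≤ b) (hbc : b ≤ c) {t : ℝ} (ht : t ∈ Ioc 0 τ) :
    Real.exp (b * t) * q (t - D) ^ 2
      ≤ Real.exp (b * D) * ((2 + 2 * D) * (inputEnergy q g (-D) 0 + q 0 ^ 2)) := by
  have hD := h.D_pos
  have hJ := inputEnergy_nonneg q g (neg_nonpos.2 hD.le)
  rcases le_or_gt (t - D) 0 with h0 | h0
  · have h1 : Real.exp (b * t) ≤ Real.exp (b * D) := Real.exp_le_exp.2 (by nlinarith)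
    exact mul_le_mul h1 (h.past_input_sq_le hd (ht.1.le.trans ht.2) ⟨by linarith [ht.1], h0⟩)
      (sq_nonneg _) (Real.exp_pos _).le
  · rw [h.input_eq (t - D) ⟨h0.le, by linarith [ht.2]⟩, mul_pow, ← Real.exp_nat_mul]
    have e : Real.exp (b * t) * (q 0 ^ 2 * Real.exp ((2 : ℕ) * (-c * (t - D))))
        -- The weight at t is the weight at t - D times exp(bD); the delay costs only this constant.
        = Real.exp (b * D) * (Real.exp ((b - 2 * c) * (t - D)) * q 0 ^ 2) := by
      have : Real.exp (b * t) * Real.exp ((2 : ℕ) * (-c * (t - D)))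
          = Real.exp (b * D) * Real.exp ((b - 2 * c) * (t - D)) := by
        rw [← Real.exp_add, ← Real.exp_add]
        congr 1
        push_cast
        ring
      linear_combination q 0 ^ 2 * this
    rw [e]
    refine mul_le_mul_of_nonneg_left ?_ (Real.exp_pos _).le
    have h1 : Real.exp ((b - 2 * c) * (t - D)) ≤ 1 :=
      Real.exp_le_one_iff.2 (mul_nonpos_of_nonpos_of_nonneg (by linarith [h.c_pos]) h0.le)
    have h2 := mul_le_of_le_one_left (sq_nonneg (q 0)) h1
    nlinarith [mul_nonneg hD.le (sq_nonneg (q 0)), mul_nonneg hD.le hJ, sq_nonneg (q 0)]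

theorem intervalIntegrable_weighted (hd : InputDeriv D c τ q g) (b : ℝ) :
    IntervalIntegrable (fun θ => Real.exp (b * θ) * (q θ ^ 2 + g θ ^ 2)) volume (-D) τ :=
  (hd.input_sq.add hd.deriv_sq).continuousOn_mul (Continuous.continuousOn (by fun_prop))

/-- The exponentially weighted input energy is bounded by the past input and its last value. -/
theorem weighted_input_le (h : ClosedLoop α β k D c sr τ q s u ux uxx)
    (hd : InputDeriv D c τ q g) {b : ℝ} (hb0 : 0 ≤ b) (hbc : b ≤ c) {t : ℝ} (ht : t ∈ Icc 0 τ) :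
    ∫ θ in (-D)..t, Real.exp (b * θ) * (q θ ^ 2 + g θ ^ 2)
      ≤ (1 + (1 + c ^ 2) / c) * (inputEnergy q g (-D) 0 + q 0 ^ 2) := by
  have hD := h.D_pos
  have hc := h.c_pos
  have hτ : 0 ≤ τ := ht.1.trans ht.2
  have iw := intervalIntegrable_weighted hd b
  have hD0 : -D ≤ 0 := by linarith
  have hJ := inputEnergy_nonneg q g hD0
  rw [← intervalIntegral.integral_add_adjacent_intervals
    (intervalIntegrable_of_subset iw le_rfl hD0 hτ) (intervalIntegrable_of_subset iw hD0 ht.1 ht.2)]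
  have e1 : ∫ θ in (-D)..0, Real.exp (b * θ) * (q θ ^ 2 + g θ ^ 2) ≤ inputEnergy q g (-D) 0 := by
    refine intervalIntegral.integral_mono_on hD0
      (intervalIntegrable_of_subset iw le_rfl hD0 hτ)
      (intervalIntegrable_of_subset (hd.input_sq.add hd.deriv_sq) le_rfl hD0 hτ) fun θ hθ => ?_
    exact mul_le_of_le_one_left (by positivity)
      (Real.exp_le_one_iff.2 (mul_nonpos_of_nonneg_of_nonpos hb0 hθ.2))
  -- At positive times q² + g² = (1 + c²) q(0)² exp(-2cθ). As b ≤ c, one factor exp(-cθ) offsets the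
  -- weight and the other gives the 1/c.
  have e2 : ∫ θ in (0 : ℝ)..t, Real.exp (b * θ) * (q θ ^ 2 + g θ ^ 2)
      ≤ ∫ θ in (0 : ℝ)..t, (1 + c ^ 2) * q 0 ^ 2 * Real.exp (-c * θ) := by
    refine intervalIntegral.integral_mono_on ht.1
      (intervalIntegrable_of_subset iw hD0 ht.1 ht.2)
      (Continuous.intervalIntegrable (by fun_prop) _ _) fun θ hθ => ?_
    have hθ' : θ ∈ Icc 0 τ := ⟨hθ.1, hθ.2.trans ht.2⟩
    rw [hd.eq_after θ hθ', h.input_eq θ hθ']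
    have e : Real.exp (b * θ) * ((q 0 * Real.exp (-c * θ)) ^ 2
        + (-c * (q 0 * Real.exp (-c * θ))) ^ 2)
        = (1 + c ^ 2) * q 0 ^ 2 * Real.exp (-c * θ)
          * (Real.exp (b * θ) * Real.exp (-c * θ)) := by ring
    rw [e, ← Real.exp_add]
    refine mul_le_of_le_one_right (by positivity) (Real.exp_le_one_iff.2 ?_)
    nlinarith [hθ.1]
  have e3 : ∫ θ in (0 : ℝ)..t, (1 + c ^ 2) * q 0 ^ 2 * Real.exp (-c * θ)
      ≤ (1 + c ^ 2) / c * q 0 ^ 2 := by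
    rw [intervalIntegral.integral_const_mul]
    have : ∫ θ in (0 : ℝ)..t, Real.exp (-c * θ) = (1 - Real.exp (-c * t)) / c := by
      rw [intervalIntegral.integral_eq_sub_of_hasDerivAt
        (f := fun θ => -Real.exp (-c * θ) / c) (fun θ _ => ?_)
        (Continuous.intervalIntegrable (by fun_prop) _ _)]
      · simp
        ring
      · have := (((hasDerivAt_id θ).const_mul (-c)).exp.neg).div_const c
        convert! this using 1
        simp
        field_simp
    rw [this]
    have h1 : (1 - Real.exp (-c * t)) / c ≤ 1 / c := by
      gcongr
      linarith [Real.exp_pos (-c * t)]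
    calc _ ≤ (1 + c ^ 2) * q 0 ^ 2 * (1 / c) := by gcongr
      _ = _ := by ring
  have h2 : 0 ≤ (1 + c ^ 2) / c * inputEnergy q g (-D) 0 := by positivity
  nlinarith [sq_nonneg (q 0)]

theorem inputEnergy_le (h : ClosedLoop α β k D c sr τ q s u ux uxx)
    (hd : InputDeriv D c τ q g) {b : ℝ} (hb0 : 0 ≤ b) (hbc : b ≤ c) {t : ℝ} (ht : t ∈ Icc 0 τ) :
    inputEnergy q g (t - D) t ≤ Real.exp (-b * t) * (Real.exp (b * D)
      * ((1 + (1 + c ^ 2) / c) * (inputEnergy q g (-D) 0 + q 0 ^ 2))) := by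
  have hD := h.D_pos
  have hw := h.weighted_input_le hd hb0 hbc ht
  have iw := intervalIntegrable_weighted hd b
  have hle : -D ≤ t - D := by linarith [ht.1]
  have hle2 : t - D ≤ t := by linarith
  rw [← intervalIntegral.integral_add_adjacent_intervals
    (intervalIntegrable_of_subset iw le_rfl hle (hle2.trans ht.2))
    (intervalIntegrable_of_subset iw hle hle2 ht.2)] at hw
  have e1 : 0 ≤ ∫ θ in (-D)..(t - D), Real.exp (b * θ) * (q θ ^ 2 + g θ ^ 2) :=
    intervalIntegral.integral_nonneg hle fun _ _ => by positivity
  have e2 : inputEnergy q g (t - D) t ≤ ∫ θ in (t - D)..t,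
      Real.exp (-b * t) * Real.exp (b * D) * (Real.exp (b * θ) * (q θ ^ 2 + g θ ^ 2)) := by
    refine intervalIntegral.integral_mono_on hle2
      (intervalIntegrable_of_subset (hd.input_sq.add hd.deriv_sq) hle hle2 ht.2)
      ((intervalIntegrable_of_subset iw hle hle2 ht.2).const_mul _) fun θ hθ => ?_
    rw [← mul_assoc, ← Real.exp_add, ← Real.exp_add]
    -- On [t - D, t] the weight exp(b(θ - t + D)) is at least 1.
    refine le_mul_of_one_le_left (by positivity) (Real.one_le_exp ?_)
    nlinarith [hθ.1]
  rw [intervalIntegral.integral_const_mul] at e2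
  refine e2.trans ?_
  rw [mul_assoc]
  gcongr
  linarith

theorem weighted_delayed_input_le (h : ClosedLoop α β k D c sr τ q s u ux uxx)
    (hd : InputDeriv D c τ q g) {b : ℝ} (hb0 : 0 ≤ b) (hbc : b ≤ c) {t₁ t₂ : ℝ} (h1 : 0 < t₁)
    (h12 : t₁ ≤ t₂) (h2 : t₂ ≤ τ) :
    ∫ t in t₁..t₂, Real.exp (b * t) * (q (t - D) ^ 2 + g (t - D) ^ 2)
      ≤ Real.exp (b * D) * ((1 + (1 + c ^ 2) / c) * (inputEnergy q g (-D) 0 + q 0 ^ 2)) := by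
  have hD := h.D_pos
  have hw := h.weighted_input_le hd hb0 hbc (t := t₂) ⟨by linarith, h2⟩
  have iw := intervalIntegrable_weighted hd b
  have a1 : -D ≤ t₁ - D := by linarith
  have a2 : t₁ - D ≤ t₂ - D := by linarith
  have a3 : t₂ - D ≤ t₂ := by linarith
  have npos : ∀ {x y : ℝ}, x ≤ y →
      0 ≤ ∫ θ in x..y, Real.exp (b * θ) * (q θ ^ 2 + g θ ^ 2) := fun hxy =>
    intervalIntegral.integral_nonneg hxy fun _ _ => by positivity
  rw [← intervalIntegral.integral_add_adjacent_intervals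
    (intervalIntegrable_of_subset iw le_rfl a1 (a2.trans (a3.trans h2)))
    (intervalIntegrable_of_subset iw a1 (a2.trans a3) h2),
    ← intervalIntegral.integral_add_adjacent_intervals
    (intervalIntegrable_of_subset iw a1 a2 (a3.trans h2))
    (intervalIntegrable_of_subset iw (a1.trans a2) a3 h2)] at hw
  have e : ∫ t in t₁..t₂, Real.exp (b * t) * (q (t - D) ^ 2 + g (t - D) ^ 2)
      = Real.exp (b * D) * ∫ θ in (t₁ - D)..(t₂ - D),
        Real.exp (b * θ) * (q θ ^ 2 + g θ ^ 2) := by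
    rw [← intervalIntegral.integral_comp_sub_right
      (fun θ => Real.exp (b * θ) * (q θ ^ 2 + g θ ^ 2)) D, ← intervalIntegral.integral_const_mul]
    refine intervalIntegral.integral_congr fun t _ => ?_
    rw [← mul_assoc, ← Real.exp_add]
    ring_nf
  rw [e]
  gcongr
  linarith [npos a1, npos a3]

theorem sq_add_three_le (x y z : ℝ) : (x + y + z) ^ 2 ≤ 3 * (x ^ 2 + y ^ 2 + z ^ 2) := by
  nlinarith [sq_nonneg (x - y), sq_nonneg (y - z), sq_nonneg (x - z)]

theorem sq_history_le (h : ClosedLoop α β k D c sr τ q s u ux uxx)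
    (hd : InputDeriv D c τ q g) {t : ℝ} (ht : t ∈ Icc 0 τ) :
    (∫ θ in (t - D)..t, q θ) ^ 2 ≤ D * inputEnergy q g (t - D) t := by
  have hD := h.D_pos
  have hle : -D ≤ t - D := by linarith [ht.1]
  have hle2 : t - D ≤ t := by linarith
  have i1 := intervalIntegrable_of_subset hd.input_sq hle hle2 ht.2
  have h1 := sq_integral_le hle2
    (h.intervalIntegrable_input ⟨hle, hle2.trans ht.2⟩ ⟨hle.trans hle2, ht.2⟩) i1
  have h2 : ∫ θ in (t - D)..t, q θ ^ 2 ≤ inputEnergy q g (t - D) t :=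
    intervalIntegral.integral_mono_on hle2 i1
      (intervalIntegrable_of_subset (hd.input_sq.add hd.deriv_sq) hle hle2 ht.2)
      fun θ _ => by nlinarith [sq_nonneg (g θ)]
  calc _ ≤ (t - (t - D)) * ∫ θ in (t - D)..t, q θ ^ 2 := h1
    _ ≤ D * inputEnergy q g (t - D) t := by
      rw [sub_sub_cancel]
      gcongr

theorem sq_integral_u_le (h : ClosedLoop α β k D c sr τ q s u ux uxx) {S : ℝ} (hsS : sr ≤ S)
    {t : ℝ} (ht : t ∈ Icc 0 τ) :
    (∫ x in (0 : ℝ)..(s t), u x t) ^ 2 ≤ S * energy s u t := by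
  have hs0 := (h.sol.s_pos t ht).le
  have c0 := continuousOn_slice h.sol.continuous_u ht
  have h1 := sq_integral_le hs0
    (ContinuousOn.intervalIntegrable (by rwa [uIcc_of_le hs0]))
    (ContinuousOn.intervalIntegrable (by rw [uIcc_of_le hs0]; exact c0.pow 2))
  refine h1.trans (mul_le_mul_of_nonneg_right ?_ (h.sol.energy_nonneg u ht))
  linarith [h.s_le_setpoint t ht]

/-- The last value of the past input is controlled by the initial state. -/
theorem initial_input_sq_le (h : ClosedLoop α β k D c sr τ q s u ux uxx)
    (hd : InputDeriv D c τ q g) {S : ℝ} (hsS : sr ≤ S) (hτ : 0 ≤ τ) :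
    q 0 ^ 2 ≤ 3 * c ^ 2 * (D * inputEnergy q g (-D) 0 + (k / α) ^ 2 * S * energy s u 0
      + (k / β) ^ 2 * (s 0 - sr) ^ 2) := by
  have h0 : (0 : ℝ) ∈ Icc 0 τ := ⟨le_rfl, hτ⟩
  have h1 := h.sq_history_le hd h0
  have h2 := h.sq_integral_u_le hsS h0
  have h3 := sq_add_three_le (∫ θ in (0 - D)..0, q θ)
    (k / α * (∫ x in (0 : ℝ)..(s 0), u x 0)) (k / β * (s 0 - sr))
  rw [h.law 0 h0, mul_pow, neg_sq]
  rw [zero_sub] at *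
  rw [mul_pow (k / α), mul_pow (k / β)] at h3
  have h4 := mul_le_mul_of_nonneg_left h2 (sq_nonneg (k / α))
  calc _ ≤ c ^ 2 * (3 * (D * inputEnergy q g (-D) 0 + (k / α) ^ 2 * (S * energy s u 0)
      + (k / β) ^ 2 * (s 0 - sr) ^ 2)) := by
        gcongr
        linarith
    _ = _ := by ring

/-- The feedback law, solved for s - s_r, expresses the interface error through the input, its
history and the heat content. No differential inequality for s is needed. -/
theorem interface_error_sq_le (h : ClosedLoop α β k D c sr τ q s u ux uxx)
    (hd : InputDeriv D c τ q g) {S : ℝ} (hsS : sr ≤ S) {t : ℝ} (ht : t ∈ Icc 0 τ) :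
    (s t - sr) ^ 2 ≤ 3 * (β / k) ^ 2 * (q t ^ 2 / c ^ 2 + D * inputEnergy q g (t - D) t
      + (k / α) ^ 2 * S * energy s u t) := by
  have hk := h.k_pos
  have hc := h.c_pos
  have hβ := h.sol.beta_pos
  have h1 := h.sq_history_le hd ht
  have h2 := mul_le_mul_of_nonneg_left (h.sq_integral_u_le hsS ht) (sq_nonneg (k / α))
  have h3 := sq_add_three_le (q t / c) (∫ θ in (t - D)..t, q θ)
    (k / α * (∫ x in (0 : ℝ)..(s t), u x t))
  have e : s t - sr = -(β / k) * (q t / c + (∫ θ in (t - D)..t, q θ)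
      + k / α * (∫ x in (0 : ℝ)..(s t), u x t)) := by
    rw [h.law t ht]
    field_simp
    ring
  rw [mul_pow (k / α), div_pow] at h3
  rw [e, mul_pow, neg_sq]
  calc _ ≤ (β / k) ^ 2 * (3 * (q t ^ 2 / c ^ 2 + D * inputEnergy q g (t - D) t
      + (k / α) ^ 2 * (S * energy s u t))) := by
        gcongr
        linarith
    _ = _ := by ring

/-- Exponential stability for real-valued state norms; `X` is the squared `H¹` norm of the initial
temperature. -/
theorem exists_exponential_bound {α β k D c : ℝ} (sr : ℝ) (hα : 0 < α) (hβ : 0 < β) (hk : 0 < k)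
    (hD : 0 < D) (hc : 0 < c) : ∃ M b : ℝ, 1 ≤ M ∧ 0 < b ∧
      ∀ {τ : ℝ} {q s g : ℝ → ℝ} {u ux uxx : ℝ → ℝ → ℝ} {X : ℝ},
        ClosedLoop α β k D c sr τ q s u ux uxx → InputDeriv D c τ q g → energy s u 0 ≤ X →
        Tendsto (fun t => energy s u t + energy s ux t) (𝓝[>] 0) (𝓝 X) →
        ∀ t ∈ Ioc 0 τ, energy s u t + energy s ux t + (s t - sr) ^ 2
            + inputEnergy q g (t - D) t
          ≤ M * Real.exp (-b * t) * (X + (s 0 - sr) ^ 2 + inputEnergy q g (-D) 0) := by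
  -- A positive bound for the domain length, chosen from s_r alone before any solution is given.
  set S : ℝ := |sr| + 1 with hSdef
  have hS : 0 < S := by positivity
  have hsS : sr ≤ S := by linarith [le_abs_self sr]
  -- The rate must not exceed the decay rate c of the input, and the Poincaré inequality must let
  -- half of the dissipation absorb b times the energy.
  set b : ℝ := min c (α / (S ^ 2 + 1)) with hbdef
  have hb : 0 < b := lt_min hc (by positivity)
  have hbc : b ≤ c := min_le_left _ _
  have hbα : b * (S ^ 2 + 1) ≤ α := (le_div_iff₀ (by positivity)).1 (min_le_right _ _)
  -- K₀ controls the past input energy plus q(0)² by the initial state; A₁, A₄ and A₂ are the decay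
  -- constants of the temperature, the interface error and the input history.
  set K₀ : ℝ := 1 + 3 * c ^ 2 * (D + (k / α) ^ 2 * S + (k / β) ^ 2) with hK₀
  set A₂ : ℝ := Real.exp (b * D) * ((1 + (1 + c ^ 2) / c) * K₀) with hA₂
  set B₀ : ℝ := Real.exp (b * D) * ((2 + 2 * D) + (1 + (1 + c ^ 2) / c)) with hB₀
  set A₁ : ℝ := 3 + (8 * S / k ^ 2 + 4 * S * (α ^ 2 + 1) / (α * k ^ 2)) * (B₀ * K₀) with hA₁
  set A₄ : ℝ := 3 * (β / k) ^ 2 * (K₀ / c ^ 2 + D * A₂ + (k / α) ^ 2 * S * A₁) with hA₄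
  have hK₀p : 0 < K₀ := by positivity
  have hA₂p : 0 < A₂ := by positivity
  have hA₁p : 3 ≤ A₁ := le_add_of_nonneg_right (by positivity)
  have hA₄p : 0 < A₄ := by positivity
  have hB₀p : 0 < B₀ := by positivity
  clear_value S b K₀ A₂ B₀ A₁ A₄
  refine ⟨A₁ + A₄ + A₂, b, by linarith, hb, ?_⟩
  intro τ q s g u ux uxx X h hd hX hlim t ht
  have hτ : 0 ≤ τ := ht.1.le.trans ht.2
  have htI := Ioc_subset_Icc_self ht
  set J := inputEnergy q g (-D) 0
  have hJ : 0 ≤ J := inputEnergy_nonneg q g (by linarith)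
  set Ξ := X + (s 0 - sr) ^ 2 + J with hΞ
  have hu0 : 0 ≤ energy s u 0 := h.sol.energy_nonneg u ⟨le_rfl, hτ⟩
  have hs2 := sq_nonneg (s 0 - sr)
  have hΞ0 : 0 ≤ Ξ := by linarith
  have hQ : J + q 0 ^ 2 ≤ K₀ * Ξ := by
    have h1 := h.initial_input_sq_le hd hsS hτ
    have h2 : D * J + (k / α) ^ 2 * S * energy s u 0 + (k / β) ^ 2 * (s 0 - sr) ^ 2
        ≤ (D + (k / α) ^ 2 * S + (k / β) ^ 2) * Ξ := by
      have e1 : D * J ≤ D * Ξ := by gcongr; linarith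
      have e2 : (k / α) ^ 2 * S * energy s u 0 ≤ (k / α) ^ 2 * S * Ξ := by gcongr; linarith
      have e3 : (k / β) ^ 2 * (s 0 - sr) ^ 2 ≤ (k / β) ^ 2 * Ξ := by gcongr; linarith
      linarith
    have h3 : 3 * c ^ 2 * (D * J + (k / α) ^ 2 * S * energy s u 0
        + (k / β) ^ 2 * (s 0 - sr) ^ 2)
        ≤ 3 * c ^ 2 * ((D + (k / α) ^ 2 * S + (k / β) ^ 2) * Ξ) := by gcongr
    have h4 : J ≤ Ξ := by linarith
    rw [hK₀]
    linarith
  have hQ0 : 0 ≤ J + q 0 ^ 2 := by positivity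
  set B := B₀ * (J + q 0 ^ 2) with hB
  have hBp : ∀ r ∈ Ioc 0 τ, Real.exp (b * r) * q (r - D) ^ 2 ≤ B := fun r hr =>
    (h.exp_mul_delayed_input_sq_le hd hb.le hbc hr).trans (by
      rw [hB, hB₀, mul_assoc]
      refine mul_le_mul_of_nonneg_left (mul_le_mul_of_nonneg_right ?_ hQ0) (Real.exp_pos _).le
      exact le_add_of_nonneg_right (by positivity))
  have hBI : ∀ r, 0 < r → r ≤ t →
      ∫ θ in r..t, Real.exp (b * θ) * (q (θ - D) ^ 2 + g (θ - D) ^ 2) ≤ B := fun r h0 hr =>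
    (h.weighted_delayed_input_le hd hb.le hbc h0 hr ht.2).trans (by
      rw [hB, hB₀, mul_assoc]
      refine mul_le_mul_of_nonneg_left (mul_le_mul_of_nonneg_right ?_ hQ0) (Real.exp_pos _).le
      exact le_add_of_nonneg_left (by positivity))
  have hexp1 : Real.exp (-b * t) * Real.exp (b * t) = 1 := by
    rw [← Real.exp_add]; simp
  have hN : energy s u t + energy s ux t ≤ Real.exp (-b * t) * (A₁ * Ξ) := by
    set C := 8 * S / k ^ 2 + 4 * S * (α ^ 2 + 1) / (α * k ^ 2)
    have hCp : 0 ≤ C := by positivity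
    -- The starting time of the energy estimate tends to 0, where the assumed convergence of the H¹
    -- norm replaces continuity of u_x.
    have hl : Tendsto (fun r => 3 * (Real.exp (b * r) * (energy s u r + energy s ux r)) + C * B)
        (𝓝[>] 0) (𝓝 (3 * (Real.exp (b * 0) * X) + C * B)) := by
      have : Tendsto (fun r => Real.exp (b * r)) (𝓝[>] 0) (𝓝 (Real.exp (b * 0))) :=
        (Continuous.tendsto (by fun_prop) _).mono_left nhdsWithin_le_nhds
      exact ((this.mul hlim).const_mul 3).add_const _
    have h1 : Real.exp (b * t) * (energy s u t + energy s ux t)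
        ≤ 3 * (Real.exp (b * 0) * X) + C * B := by
      refine ge_of_tendsto hl ?_
      filter_upwards [Ioc_mem_nhdsGT ht.1] with r hr
      exact h.energy_decay hS hsS hb.le hbα hd.deriv hd.deriv_sq hd.sub_eq hr.1 hr.2 ht.2 hBp
        (hBI r hr.1 hr.2)
    have h2 : C * B ≤ C * (B₀ * (K₀ * Ξ)) := by
      rw [hB]
      gcongr
    have h3 : X ≤ Ξ := by linarith
    have h4 : Real.exp (b * t) * (energy s u t + energy s ux t) ≤ A₁ * Ξ := by
      rw [mul_zero, Real.exp_zero, one_mul] at h1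
      rw [hA₁]
      linarith
    calc energy s u t + energy s ux t
        = Real.exp (-b * t) * (Real.exp (b * t) * (energy s u t + energy s ux t)) := by
          rw [← mul_assoc, hexp1, one_mul]
      _ ≤ _ := by gcongr
  have hH : inputEnergy q g (t - D) t ≤ Real.exp (-b * t) * (A₂ * Ξ) := by
    refine (h.inputEnergy_le hd hb.le hbc htI).trans ?_
    rw [hA₂, mul_assoc (Real.exp (b * D)), mul_assoc (1 + (1 + c ^ 2) / c)]
    have : 0 ≤ 1 + (1 + c ^ 2) / c := by positivity
    exact mul_le_mul_of_nonneg_left (mul_le_mul_of_nonneg_left (mul_le_mul_of_nonneg_left hQ this)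
      (Real.exp_pos _).le) (Real.exp_pos _).le
  have hq : q t ^ 2 ≤ Real.exp (-b * t) * (K₀ * Ξ) := by
    rw [h.input_eq t htI, mul_pow, ← Real.exp_nat_mul, mul_comm]
    have h1 : Real.exp ((2 : ℕ) * (-c * t)) ≤ Real.exp (-b * t) := by
      refine Real.exp_le_exp.2 ?_
      push_cast
      nlinarith [ht.1]
    exact mul_le_mul h1 (by linarith) (sq_nonneg _) (Real.exp_pos _).le
  have hs : (s t - sr) ^ 2 ≤ Real.exp (-b * t) * (A₄ * Ξ) := by
    refine (h.interface_error_sq_le hd hsS htI).trans ?_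
    have hF := h.sol.energy_nonneg ux htI
    have hL : energy s u t ≤ Real.exp (-b * t) * (A₁ * Ξ) := by linarith
    calc _ ≤ 3 * (β / k) ^ 2 * ((Real.exp (-b * t) * (K₀ * Ξ)) / c ^ 2
          + D * (Real.exp (-b * t) * (A₂ * Ξ))
          + (k / α) ^ 2 * S * (Real.exp (-b * t) * (A₁ * Ξ))) := by gcongr
      _ = _ := by rw [hA₄]; ring
  calc _ ≤ Real.exp (-b * t) * (A₁ * Ξ) + Real.exp (-b * t) * (A₄ * Ξ)
        + Real.exp (-b * t) * (A₂ * Ξ) := by linarith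
    _ = _ := by ring

end ClosedLoop

/-! ### Sobolev norms of the closed-loop state -/

theorem IsWeakDeriv.congr {f f' g : ℝ → ℝ} {a b : ℝ} (h : IsWeakDeriv a b f g)
    (hf : EqOn f f' (Ioo a b)) : IsWeakDeriv a b f' g := by
  have hlc : IsLocallyClosed (Ioo a b) := isOpen_Ioo.isLocallyClosed
  refine ⟨?_, h.2.1, fun φ hφ hc hs => ?_⟩
  · rw [locallyIntegrableOn_iff hlc]
    exact fun K hK hKc => (h.1.integrableOn_compact_subset hK hKc).congr_fun
      (fun x hx => hf (hK hx)) hKc.measurableSet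
  · rw [← h.2.2 φ hφ hc hs]
    refine setIntegral_congr_fun measurableSet_Ioo fun x hx => ?_
    simp only [hf hx]

theorem h1NormSq_congr {f f' : ℝ → ℝ} {a b : ℝ} (hf : EqOn f f' (Ioo a b)) :
    h1NormSq a b f = h1NormSq a b f' := by
  have key : ∀ {f f' : ℝ → ℝ}, EqOn f f' (Ioo a b) → h1NormSq a b f ≤ h1NormSq a b f' := by
    intro f f' hf
    refine le_iInf₂ fun g hg => (iInf₂_le g (hg.congr hf.symm)).trans (le_of_eq ?_)
    refine setLIntegral_congr_fun measurableSet_Ioo fun x hx => ?_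
    simp only [hf hx]
  exact le_antisymm (key hf) (key hf.symm)

theorem ofReal_integral_eq_lintegral_Ioo {f : ℝ → ℝ} {a b : ℝ} (hab : a ≤ b)
    (hf : IntervalIntegrable f volume a b) (h0 : ∀ x, 0 ≤ f x) :
    ENNReal.ofReal (∫ x in a..b, f x) = ∫⁻ x in Ioo a b, ENNReal.ofReal (f x) := by
  rw [intervalIntegral.integral_of_le hab, integral_Ioc_eq_integral_Ioo]
  exact ofReal_integral_eq_lintegral_ofReal
    ((intervalIntegrable_iff_integrableOn_Ioo_of_le hab).1 hf) (.of_forall h0)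

theorem IsWeakDeriv.integrableOn_of_ne_top {f g : ℝ → ℝ} {a b : ℝ} (h : IsWeakDeriv a b f g)
    (hJ : ∫⁻ x in Ioo a b, ENNReal.ofReal (f x ^ 2 + g x ^ 2) ≠ ⊤) :
    IntegrableOn (fun x => f x ^ 2) (Ioo a b) ∧ IntegrableOn (fun x => g x ^ 2) (Ioo a b) ∧
      IntegrableOn g (Ioo a b) := by
  have mf := h.1.aestronglyMeasurable
  have mg := h.2.1.aestronglyMeasurable
  have hi : IntegrableOn (fun x => f x ^ 2 + g x ^ 2) (Ioo a b) :=
    (lintegral_ofReal_ne_top_iff_integrable ((mf.pow 2).add (mg.pow 2))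
      (.of_forall fun x => add_nonneg (sq_nonneg (f x)) (sq_nonneg (g x)))).1 hJ
  have hg2 : IntegrableOn (fun x => g x ^ 2) (Ioo a b) :=
    Integrable.mono hi (mg.pow 2) (.of_forall fun x => by
      rw [Real.norm_of_nonneg (sq_nonneg _), Real.norm_of_nonneg (by positivity)]
      nlinarith [sq_nonneg (f x)])
  refine ⟨Integrable.mono hi (mf.pow 2) (.of_forall fun x => ?_), hg2, ?_⟩
  · rw [Real.norm_of_nonneg (sq_nonneg _), Real.norm_of_nonneg (by positivity)]
    nlinarith [sq_nonneg (g x)]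
  · have h1 : IntegrableOn (fun _ : ℝ => (1 : ℝ)) (Ioo a b) := by simp
    refine Integrable.mono (h1.add hg2) mg (.of_forall fun x => ?_)
    simp only [Pi.add_apply]
    rw [Real.norm_of_nonneg (r := 1 + g x ^ 2) (by positivity), Real.norm_eq_abs]
    nlinarith [sq_nonneg (|g x| - 1), sq_abs (g x)]

namespace MovingHeat

variable {α β τ : ℝ} {s : ℝ → ℝ} {u ux uxx : ℝ → ℝ → ℝ}

theorem h1NormSq_eq_energy (h : MovingHeat α β τ s u ux uxx) {t : ℝ} (ht : t ∈ Ioc 0 τ) :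
    h1NormSq 0 (s t) (fun x => u x t) = ENNReal.ofReal (energy s u t + energy s ux t) := by
  have hs := h.s_pos t (Ioc_subset_Icc_self ht)
  have c0 := continuousOn_slice h.continuous_u' ht
  have c1 := continuousOn_slice h.continuous_ux ht
  have i0 : IntervalIntegrable (fun x => u x t ^ 2) volume 0 (s t) :=
    ContinuousOn.intervalIntegrable (by rw [uIcc_of_le hs.le]; exact c0.pow 2)
  have i1 : IntervalIntegrable (fun x => ux x t ^ 2) volume 0 (s t) :=
    ContinuousOn.intervalIntegrable (by rw [uIcc_of_le hs.le]; exact c1.pow 2)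
  rw [h1NormSq_eq (isWeakDeriv_of_primitive hs (c0.mono Ioo_subset_Icc_self)
      ((c1.mono Ioo_subset_Icc_self).locallyIntegrableOn measurableSet_Ioo)
      fun x hx y hy hxy => (h.integral_ux ht hx.1.le hxy hy.2.le).symm), energy, energy,
    ← intervalIntegral.integral_add i0 i1,
    ofReal_integral_eq_lintegral_Ioo hs.le (i0.add i1) fun x => by positivity]

/-- Every competitor in the infimum contains the L² part, so this also holds at t = 0, where no
derivative of u is given. -/
theorem ofReal_energy_le_h1NormSq (h : MovingHeat α β τ s u ux uxx) {t : ℝ} (ht : t ∈ Icc 0 τ) :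
    ENNReal.ofReal (energy s u t) ≤ h1NormSq 0 (s t) (fun x => u x t) := by
  have hs := h.s_pos t ht
  have c0 := continuousOn_slice h.continuous_u ht
  rw [energy, ofReal_integral_eq_lintegral_Ioo hs.le (ContinuousOn.intervalIntegrable (by
    rw [uIcc_of_le hs.le]; exact c0.pow 2)) fun x => sq_nonneg _]
  refine le_iInf₂ fun g _ => lintegral_mono fun x => ENNReal.ofReal_le_ofReal ?_
  nlinarith [sq_nonneg (g x)]

end MovingHeat

namespace ClosedLoop

open MovingHeat

variable {α β k D c sr τ : ℝ} {q s g : ℝ → ℝ} {u ux uxx : ℝ → ℝ → ℝ}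

/-- Finiteness of the past norm supplies a weak derivative; reflecting it and continuing it by -cq
gives a derivative of q across 0, because q is continuous there. -/
theorem exists_inputDeriv (h : ClosedLoop α β k D c sr τ q s u ux uxx) (hτ : 0 ≤ τ)
    (hfin : h1NormSq 0 D (fun x => q (0 - x)) ≠ ⊤) :
    ∃ g, InputDeriv D c τ q g ∧
      h1NormSq 0 D (fun x => q (0 - x)) = ENNReal.ofReal (inputEnergy q g (-D) 0) := by
  have hD := h.D_pos
  -- Without a weak derivative the infimum would run over the empty family and be ⊤.
  obtain ⟨g₀, hg₀⟩ : ∃ g₀, IsWeakDeriv 0 D (fun x => q (0 - x)) g₀ := by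
    by_contra! hno
    exact hfin (iInf₂_eq_top.2 fun g hg => (hno g hg).elim)
  rw [h1NormSq_eq hg₀] at hfin ⊢
  obtain ⟨if2, ig2, ig⟩ := hg₀.integrableOn_of_ne_top hfin
  rw [← intervalIntegrable_iff_integrableOn_Ioo_of_le hD.le] at if2 ig2 ig
  have refl : ∀ {w : ℝ → ℝ}, IntervalIntegrable w volume 0 D →
      IntervalIntegrable (fun θ => w (0 - θ)) volume (-D) 0 := fun hw => by
    have := (hw.comp_sub_left 0).symm
    simpa only [zero_sub, neg_zero, sub_zero] using this
  have hcq : ContinuousOn q (Icc 0 τ) :=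
    h.continuous_input.mono fun t ht => ⟨by linarith [ht.1], ht.2⟩
  set g : ℝ → ℝ := fun θ => if θ < 0 then -g₀ (0 - θ) else -c * q θ with hg
  have hgneg : ∀ θ, θ < 0 → g θ = -g₀ (0 - θ) := fun θ hθ => if_pos hθ
  have hgpos : ∀ θ, 0 ≤ θ → g θ = -c * q θ := fun θ hθ => if_neg (not_lt.2 hθ)
  have aeneg : ∀ {w w' : ℝ → ℝ}, (∀ θ < 0, w θ = w' θ) →
      IntervalIntegrable w volume (-D) 0 → IntervalIntegrable w' volume (-D) 0 :=
    fun hw hi => by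
      rw [intervalIntegrable_iff_integrableOn_Ioo_of_le (by linarith)] at hi ⊢
      exact hi.congr_fun (fun θ hθ => hw θ hθ.2) measurableSet_Ioo
  have pospart : ∀ {w w' : ℝ → ℝ}, (∀ θ, 0 ≤ θ → w θ = w' θ) → ContinuousOn w (Icc 0 τ) →
      IntervalIntegrable w' volume 0 τ := fun hw hc => by
    refine ContinuousOn.intervalIntegrable ?_
    rw [uIcc_of_le hτ]
    exact hc.congr fun θ hθ => (hw θ hθ.1).symm
  have hq2 : IntervalIntegrable (fun θ => q θ ^ 2) volume (-D) τ :=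
    (aeneg (fun θ _ => by simp) (refl if2)).trans (pospart (fun _ _ => rfl) (hcq.pow 2))
  have hgi : IntervalIntegrable g volume (-D) τ :=
    (aeneg (fun θ hθ => (hgneg θ hθ).symm) (refl ig).neg).trans
      (pospart (fun θ hθ => (hgpos θ hθ).symm) (continuousOn_const.mul hcq))
  have hg2i : IntervalIntegrable (fun θ => g θ ^ 2) volume (-D) τ :=
    (aeneg (fun θ hθ => by rw [hgneg θ hθ, neg_sq]) (refl ig2)).trans
      (pospart (w := fun θ => (-c * q θ) ^ 2) (fun θ hθ => by rw [hgpos θ hθ])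
        ((continuousOn_const.mul hcq).pow 2))
  have hD0 : -D ≤ 0 := by linarith
  have hcf : ContinuousOn (fun x => q (0 - x)) (Ioo 0 D) :=
    h.continuous_input.comp (continuousOn_const.sub continuousOn_id) fun x hx =>
      ⟨by linarith [hx.2], by linarith [hx.1]⟩
  have hpast : ∀ x ∈ Ioo (-D) 0, ∀ y ∈ Ico x 0, q y - q x = ∫ θ in x..y, g θ := by
    intro x hx y hy
    have h1 := hg₀.sub_eq_integral hcf (x := -y) (y := -x) ⟨by linarith [hy.2], by
      linarith [hx.1, hy.1]⟩ ⟨by linarith [hx.2], by linarith [hx.1]⟩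
    have h2 : ∫ θ in x..y, g θ = ∫ θ in x..y, -g₀ (-θ) := by
      refine intervalIntegral.integral_congr fun θ hθ => ?_
      rw [uIcc_of_le hy.1] at hθ
      rw [hgneg θ (hθ.2.trans_lt hy.2), zero_sub]
    rw [h2, intervalIntegral.integral_neg, intervalIntegral.integral_comp_neg (fun θ => g₀ θ),
      ← h1]
    simp
  have hbase : ∀ x ∈ Ioc (-D) τ, q x - q 0 = ∫ θ in (0 : ℝ)..x, g θ := by
    intro x hx
    rcases lt_or_ge x 0 with h0 | h0
    · have c1 : ContinuousOn (fun y => q y - q x) (Icc x 0) :=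
        (h.continuous_input.mono fun y hy => ⟨hx.1.trans_le hy.1, hy.2.trans hτ⟩).sub
          continuousOn_const
      have c2 : ContinuousOn (fun y => ∫ θ in x..y, g θ) (Icc x 0) := by
        have := intervalIntegral.continuousOn_primitive_interval'
          (intervalIntegrable_of_subset hgi hx.1.le h0.le hτ) left_mem_uIcc
        rwa [uIcc_of_le h0.le] at this
      -- The weak derivative determines increments only for negative times; continuity at 0 carries
      -- the identity to the end point.
      have hEq : EqOn (fun y => q y - q x) (fun y => ∫ θ in x..y, g θ) (Ico x 0) :=
        fun y hy => hpast x ⟨hx.1, h0⟩ y hy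
      have := hEq.of_subset_closure c1 c2 Ico_subset_Icc_self (by rw [closure_Ico h0.ne])
        (right_mem_Icc.2 h0.le)
      simp only at this
      rw [intervalIntegral.integral_symm, ← this]
      ring
    · have h1 : ∫ θ in (0 : ℝ)..x, g θ = ∫ θ in (0 : ℝ)..x, -c * (q 0 * Real.exp (-c * θ)) := by
        refine intervalIntegral.integral_congr fun θ hθ => ?_
        rw [uIcc_of_le h0] at hθ
        rw [hgpos θ hθ.1, h.input_eq θ ⟨hθ.1, hθ.2.trans hx.2⟩]
      rw [h1, intervalIntegral.integral_eq_sub_of_hasDerivAt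
        (f := fun θ => q 0 * Real.exp (-c * θ)) (fun θ _ => ?_)
        (Continuous.intervalIntegrable (by fun_prop) _ _), h.input_eq x ⟨h0, hx.2⟩]
      · simp
      · have := ((hasDerivAt_id θ).const_mul (-c)).exp.const_mul (q 0)
        convert! this using 1
        simp
        ring
  have h0mem : (0 : ℝ) ∈ Icc (-D) τ := ⟨hD0, hτ⟩
  have hii : ∀ x ∈ Ioc (-D) τ, IntervalIntegrable g volume 0 x := fun x hx =>
    hgi.mono_set (by
      rw [uIcc_of_le (hD0.trans hτ)]
      exact ordConnected_Icc.uIcc_subset h0mem (Ioc_subset_Icc_self hx))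
  refine ⟨g, ⟨hq2, hgi, hg2i, fun x hx y hy _ => ?_, fun θ hθ => hgpos θ hθ.1⟩, ?_⟩
  · rw [← intervalIntegral.integral_interval_sub_left (hii y hy) (hii x hx), ← hbase y hy,
      ← hbase x hx]
    ring
  · rw [← ofReal_integral_eq_lintegral_Ioo hD.le (if2.add ig2) fun x => by positivity, inputEnergy]
    congr 1
    have e := intervalIntegral.integral_comp_sub_left (a := -D) (b := 0)
      (fun x => q (0 - x) ^ 2 + g₀ x ^ 2) 0
    simp only [sub_zero, zero_sub, neg_neg] at e ⊢
    rw [← e]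
    -- At θ = 0 the other branch defines g; one point does not affect the integral.
    refine intervalIntegral.integral_congr_ae ?_
    filter_upwards [(measure_eq_zero_iff_ae_notMem.1 (Real.volume_singleton (a := 0)))]
      with θ hθ0 hθ
    rw [uIoc_of_le hD0] at hθ
    rw [hgneg θ (lt_of_le_of_ne hθ.2 hθ0), zero_sub, neg_sq]

theorem h1NormSq_history_le (h : ClosedLoop α β k D c sr τ q s u ux uxx)
    (hd : InputDeriv D c τ q g) {t : ℝ} (ht : t ∈ Icc 0 τ) :
    h1NormSq 0 D (fun x => q (t - x)) ≤ ENNReal.ofReal (inputEnergy q g (t - D) t) := by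
  have hD := h.D_pos
  have hle : -D ≤ t - D := by linarith [ht.1]
  have hle2 : t - D ≤ t := by linarith
  have refl : ∀ {w : ℝ → ℝ}, IntervalIntegrable w volume (-D) τ →
      IntervalIntegrable (fun x => w (t - x)) volume 0 D := fun hw => by
    have := ((intervalIntegrable_of_subset hw hle hle2 ht.2).comp_sub_left t).symm
    simpa only [sub_self, sub_sub_cancel] using this
  have ig := (refl hd.deriv).neg
  have hw : IsWeakDeriv 0 D (fun x => q (t - x)) (fun x => -g (t - x)) := by
    refine isWeakDeriv_of_primitive hD ?_ ?_ fun x hx y hy hxy => ?_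
    · exact h.continuous_input.comp (continuousOn_const.sub continuousOn_id) fun x hx =>
        ⟨by linarith [hx.2, ht.1], by linarith [hx.1, ht.2]⟩
    · exact ((intervalIntegrable_iff_integrableOn_Ioo_of_le hD.le).1 ig).locallyIntegrableOn
    · rw [intervalIntegral.integral_neg, intervalIntegral.integral_comp_sub_left (fun θ => g θ),
        ← hd.sub_eq (t - y) ⟨by linarith [hy.2, ht.1], by linarith [hy.1, ht.2]⟩ (t - x)
          ⟨by linarith [hx.2, ht.1], by linarith [hx.1, ht.2]⟩ (by linarith)]
      ring
  rw [h1NormSq_eq hw, ← ofReal_integral_eq_lintegral_Ioo hD.le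
    ((refl hd.input_sq).add (by simpa only [neg_sq] using refl hd.deriv_sq))
    fun x => by positivity]
  have e := intervalIntegral.integral_comp_sub_left (a := 0) (b := D)
    (fun θ => q θ ^ 2 + g θ ^ 2) t
  rw [sub_zero] at e
  rw [inputEnergy, ← e]
  simp only [neg_sq, le_refl]

end ClosedLoop

/-! ### The Stefan problem -/

theorem Params.alpha_pos (P : Params) : 0 < P.alpha :=
  div_pos P.k_pos (mul_pos P.rho_pos P.Cp_pos)

theorem Params.beta_pos (P : Params) : 0 < P.beta :=
  div_pos P.k_pos (mul_pos P.rho_pos P.latentHeat_pos)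

namespace IsStefanSolution

variable {P : Params} {c sr s₀ : ℝ} {T₀ q s : ℝ → ℝ} {T : ℝ → ℝ → ℝ} {τ : EReal}

theorem movingHeat (h : IsStefanSolution P s₀ T₀ τ q s T) {r : ℝ} (hr : (r : EReal) < τ) :
    MovingHeat P.alpha P.beta r s (fun x t => T x t - P.Tm) (spaceDeriv s T)
      (spaceDeriv s (spaceDeriv s T)) := by
  have hlt : ∀ {t : ℝ}, t ≤ r → (t : EReal) < τ := fun ht =>
    (EReal.coe_le_coe_iff.2 ht).trans_lt hr
  exact
  { alpha_pos := P.alpha_pos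
    beta_pos := P.beta_pos
    continuous_s := h.continuous_interface.mono fun t ht => ⟨ht.1, hlt ht.2⟩
    s_pos := fun t ht => h.interface_pos t ht.1 (hlt ht.2)
    continuous_u := (h.continuous_temp.mono fun p hp =>
      ⟨hp.1.1, hlt hp.1.2, hp.2.1, hp.2.2⟩).sub continuousOn_const
    deriv_u := fun t ht x hx =>
      (h.differentiable_temp t ht.1 (hlt ht.2) x hx).hasDerivWithinAt.sub_const P.Tm
    continuous_ux := h.continuous_spaceDeriv.mono fun p hp =>
      ⟨hp.1.1, hlt hp.1.2, hp.2.1, hp.2.2⟩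
    deriv_ux := fun t ht x hx =>
      (h.differentiable_spaceDeriv t ht.1 (hlt ht.2) x hx).hasDerivWithinAt
    continuous_uxx := h.continuous_spaceDeriv₂.mono fun p hp =>
      ⟨hp.1.1, hlt hp.1.2, hp.2.1, hp.2.2⟩
    heat := fun t ht x hx hxs => (h.heat_equation t ht.1 (hlt ht.2) x hx hxs).sub_const P.Tm
    interface := fun t ht => by simp only [h.interface_temp t ht.1 (hlt ht.2), sub_self]
    stefan := fun t ht => h.stefan_condition t ht.1 (hlt ht.2) }

theorem initial_temp_nonneg (h : IsStefanSolution P s₀ T₀ τ q s T) (hτ : 0 < τ)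
    (ha : AdmissibleInitial P s₀ T₀) : ∀ x ∈ Icc 0 (s 0), 0 ≤ T x 0 - P.Tm := by
  obtain ⟨hs₀, H, _, hT⟩ := ha
  have hm := h.movingHeat (r := 0) hτ
  have c0 := MovingHeat.continuousOn_slice (G := fun x t => T x t - P.Tm) hm.continuous_u
    (r := 0) ⟨le_rfl, le_rfl⟩
  have hcl : closure (Ioo 0 (s 0)) = Icc 0 (s 0) := closure_Ioo (hm.s_pos 0 (by simp)).ne
  intro x hx
  rw [← hcl] at hx c0
  refine le_on_closure (f := fun _ => (0 : ℝ)) (fun y hy => ?_) continuousOn_const c0 hx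
  rw [h.initial_interface] at hy
  rw [h.initial_temp y (Ioo_subset_Icc_self hy)]
  linarith [(hT y hy).1]

/-- At t = 0 the feedback law reads q(0) = (ck/β) times the gap in the setpoint restriction. -/
theorem initial_input_pos (h : IsStefanSolution P s₀ T₀ τ q s T) (hτ : 0 < τ) (hc : 0 < c)
    (ha : AdmissibleInitial P s₀ T₀) (hsp : SetpointRestriction P s₀ T₀ q sr)
    (hf : FeedbackLaw P c sr τ q s T) : 0 < q 0 := by
  have h0 := hf 0 le_rfl hτ
  have e : ∫ x in (0 : ℝ)..s₀, (T x 0 - P.Tm) = ∫ x in (0 : ℝ)..s₀, (T₀ x - P.Tm) := by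
    refine intervalIntegral.integral_congr fun x hx => ?_
    rw [uIcc_of_le ha.1.le] at hx
    simp only [h.initial_temp x hx]
  rw [h.initial_interface, e, zero_sub] at h0
  have hα := P.alpha_pos
  have hβ := P.beta_pos
  have hk := P.k_pos
  rw [SetpointRestriction, intervalIntegral.integral_div] at hsp
  have e2 : q 0 = c * (P.k / P.beta) * (sr - (s₀ + P.beta * ((∫ t in (-P.D)..0, q t) / P.k
      + 1 / P.alpha * ∫ x in (0 : ℝ)..s₀, (T₀ x - P.Tm)))) := by
    rw [h0]
    field_simp
    ring
  rw [e2]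
  exact mul_pos (mul_pos hc (div_pos hk hβ)) (sub_pos.2 hsp)

theorem closedLoop (h : IsStefanSolution P s₀ T₀ τ q s T) (hτ : 0 < τ) (hc : 0 < c)
    (ha : AdmissibleInitial P s₀ T₀) (hp : NonnegPast P q)
    (hsp : SetpointRestriction P s₀ T₀ q sr) (hf : FeedbackLaw P c sr τ q s T) {r : ℝ}
    (hr : (r : EReal) < τ) :
    ClosedLoop P.alpha P.beta P.k P.D c sr r q s (fun x t => T x t - P.Tm) (spaceDeriv s T)
      (spaceDeriv s (spaceDeriv s T)) := by
  have hlt : ∀ {t : ℝ}, t ≤ r → (t : EReal) < τ := fun ht =>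
    (EReal.coe_le_coe_iff.2 ht).trans_lt hr
  exact
  { k_pos := P.k_pos
    D_pos := P.D_pos
    c_pos := hc
    sol := h.movingHeat hr
    integrable_past := h.integrable_past
    continuous_input := h.continuous_input.mono fun t ht => ⟨ht.1, hlt ht.2⟩
    flux := fun t ht => h.boundary_flux t ht.1 (hlt ht.2)
    law := fun t ht => hf t ht.1 (hlt ht.2)
    initial_nonneg := h.initial_temp_nonneg hτ ha
    past_nonneg := hp
    initial_input_pos := h.initial_input_pos hτ hc ha hsp hf }

theorem h1NormSq_initial (h : IsStefanSolution P s₀ T₀ τ q s T) :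
    h1NormSq 0 (s 0) (fun x => T x 0 - P.Tm) = h1NormSq 0 s₀ (fun x => T₀ x - P.Tm) := by
  rw [h.initial_interface]
  exact h1NormSq_congr fun x hx => by simp only [h.initial_temp x (Ioo_subset_Icc_self hx)]

/-- At positive times the classical derivative is a weak one, so the assumed convergence of the H¹
norm is convergence of the energies; finiteness of the limit allows real values. -/
theorem tendsto_energy (h : IsStefanSolution P s₀ T₀ τ q s T) {r : ℝ} (hr0 : 0 < r)
    (hr : (r : EReal) < τ) (hfin : h1NormSq 0 (s 0) (fun x => T x 0 - P.Tm) ≠ ⊤) :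
    Tendsto (fun t => MovingHeat.energy s (fun x t => T x t - P.Tm) t
      + MovingHeat.energy s (spaceDeriv s T) t) (𝓝[>] 0)
      (𝓝 (h1NormSq 0 (s 0) (fun x => T x 0 - P.Tm)).toReal) := by
  have hm := h.movingHeat hr
  have h1 := h.h1_initial
  rw [← h.h1NormSq_initial] at h1
  refine ((ENNReal.tendsto_toReal hfin).comp h1).congr' ?_
  filter_upwards [Ioc_mem_nhdsGT hr0] with t ht
  have htI := Ioc_subset_Icc_self ht
  rw [Function.comp_apply, hm.h1NormSq_eq_energy ht, ENNReal.toReal_ofReal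
    (add_nonneg (hm.energy_nonneg _ htI) (hm.energy_nonneg _ htI))]

end IsStefanSolution

end DelayedStefan

end

theorem theorem1 (P : DelayedStefan.Params) (c sr : ℝ) (hc : 0 < c) :
    ∃ M b : ℝ, 0 < M ∧ 0 < b ∧
      ∀ (τ : EReal) (_ : 0 < τ) (s₀ : ℝ) (T₀ q s : ℝ → ℝ) (T : ℝ → ℝ → ℝ),
        DelayedStefan.AdmissibleInitial P s₀ T₀ →
        DelayedStefan.NonnegPast P q →
        DelayedStefan.SetpointRestriction P s₀ T₀ q sr →
        DelayedStefan.IsStefanSolution P s₀ T₀ τ q s T →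
        DelayedStefan.FeedbackLaw P c sr τ q s T →
          (∀ t : ℝ, 0 < t → (t : EReal) < τ → ∀ x ∈ Set.Icc 0 (s t), P.Tm ≤ T x t) ∧
          (∀ t : ℝ, 0 ≤ t → (t : EReal) < τ →
            DelayedStefan.stateNormSq P sr q s T t ≤
              ENNReal.ofReal (M * Real.exp (-b * t)) *
                DelayedStefan.stateNormSq P sr q s T 0) := by
  obtain ⟨M, b, hM, hb, hmain⟩ := DelayedStefan.ClosedLoop.exists_exponential_bound sr
    P.alpha_pos P.beta_pos P.k_pos P.D_pos hc
  have hM0 : 0 < M := by linarith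
  refine ⟨M, b, hM0, hb, fun τ hτ s₀ T₀ q s T ha hp hsp h hf => ⟨fun t ht htτ x hx => ?_,
    fun t ht htτ => ?_⟩⟩
  · have := (h.closedLoop hτ hc ha hp hsp hf htτ).temp_nonneg t ⟨ht.le, le_rfl⟩ x hx
    linarith
  -- The real estimate covers positive times only; at t = 0 the bound is M ≥ 1.
  rcases ht.eq_or_lt with rfl | ht0
  · rw [mul_zero, Real.exp_zero, mul_one]
    exact le_mul_of_one_le_left zero_le (ENNReal.one_le_ofReal.2 hM)
  have hcoef : 0 < M * Real.exp (-b * t) := mul_pos hM0 (Real.exp_pos _)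
  -- An infinite initial norm makes the right side infinite, since its coefficient is positive.
  -- Otherwise the past input has a square-integrable derivative and the real-valued estimate
  -- applies on [0, t].
  by_cases hfin : DelayedStefan.stateNormSq P sr q s T 0 = ⊤
  · rw [hfin, ENNReal.mul_top (ENNReal.ofReal_pos.2 hcoef).ne']
    exact le_top
  have hcl := h.closedLoop hτ hc ha hp hsp hf htτ
  rw [DelayedStefan.stateNormSq, ENNReal.add_eq_top, ENNReal.add_eq_top, not_or, not_or] at hfin
  obtain ⟨⟨hfinT, _⟩, hfinq⟩ := hfin
  obtain ⟨g, hd, hq⟩ := hcl.exists_inputDeriv ht hfinq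
  have htI : t ∈ Set.Ioc 0 t := ⟨ht0, le_rfl⟩
  have htI' : t ∈ Set.Icc 0 t := ⟨ht, le_rfl⟩
  have hX : DelayedStefan.MovingHeat.energy s (fun x t => T x t - P.Tm) 0
      ≤ (DelayedStefan.h1NormSq 0 (s 0) (fun x => T x 0 - P.Tm)).toReal :=
    (ENNReal.ofReal_le_iff_le_toReal hfinT).1
      (hcl.sol.ofReal_energy_le_h1NormSq (t := 0) ⟨le_rfl, ht⟩)
  have key := hmain hcl hd hX (h.tendsto_energy ht0 htτ hfinT) t htI
  have hE : 0 ≤ DelayedStefan.MovingHeat.energy s (fun x t => T x t - P.Tm) t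
      + DelayedStefan.MovingHeat.energy s (DelayedStefan.spaceDeriv s T) t :=
    add_nonneg (hcl.sol.energy_nonneg _ htI') (hcl.sol.energy_nonneg _ htI')
  have hJ := DelayedStefan.ClosedLoop.inputEnergy_nonneg q g (neg_nonpos.2 P.D_pos.le)
  have hJt := DelayedStefan.ClosedLoop.inputEnergy_nonneg q g (sub_le_self t P.D_pos.le)
  calc DelayedStefan.stateNormSq P sr q s T t
      ≤ ENNReal.ofReal (DelayedStefan.MovingHeat.energy s (fun x t => T x t - P.Tm) t
          + DelayedStefan.MovingHeat.energy s (DelayedStefan.spaceDeriv s T) t)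
        + ENNReal.ofReal ((s t - sr) ^ 2)
        + ENNReal.ofReal (DelayedStefan.inputEnergy q g (t - P.D) t) := by
        rw [DelayedStefan.stateNormSq, hcl.sol.h1NormSq_eq_energy htI]
        exact add_le_add le_rfl (hcl.h1NormSq_history_le hd htI')
    _ = ENNReal.ofReal (DelayedStefan.MovingHeat.energy s (fun x t => T x t - P.Tm) t
          + DelayedStefan.MovingHeat.energy s (DelayedStefan.spaceDeriv s T) t
          + (s t - sr) ^ 2 + DelayedStefan.inputEnergy q g (t - P.D) t) := by
        rw [ENNReal.ofReal_add (by positivity) hJt, ENNReal.ofReal_add hE (sq_nonneg _)]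
    _ ≤ ENNReal.ofReal (M * Real.exp (-b * t)
          * ((DelayedStefan.h1NormSq 0 (s 0) (fun x => T x 0 - P.Tm)).toReal + (s 0 - sr) ^ 2
            + DelayedStefan.inputEnergy q g (-P.D) 0)) := ENNReal.ofReal_le_ofReal key
    _ = ENNReal.ofReal (M * Real.exp (-b * t)) * DelayedStefan.stateNormSq P sr q s T 0 := by
        rw [ENNReal.ofReal_mul hcoef.le, DelayedStefan.stateNormSq, hq,
          ENNReal.ofReal_add (by positivity) hJ,
          ENNReal.ofReal_add ENNReal.toReal_nonneg (sq_nonneg _), ENNReal.ofReal_toReal hfinT]
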